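/- Let $q$ be a prime power, $n\ge 2$, $d=\lfloor n/2\rfloor$. The alternating forms graph $A_q(n)$ has as vertices the skew symmetric $n\times n$ matrices over $\mathbb F_q$ with zero diagonal, two being adjacent when their difference has rank $2$. Put $b=q^2$, $m=2n-2d-1$, and for $0\le i,j\le d$ let $$A_j(i)=\sum_{h=0}^{j}(-1)^{j-h}\,q^{(j-h)(j-h-1)}\,q^{hm}\begin{bmatrix} d-h\\ d-j\end{bmatrix}_b\begin{bmatrix} d-i\\ h\end{bmatrix}_b ,\qquad \begin{bmatrix} r\\ s\end{bmatrix}_b=\prod_{t=0}^{s-1}\frac{b^{r-t}-1}{b^{s-t}-1}.$$ The numbers $A_j(i)$ are the entries $P_{ij}$ of the eigenmatrix of $A_q(n)$: the graph has diameter $d$, $A_0(i)=1$ for $0\le i\le d$, $A_1(0)>A_1(1)>\dots>A_1(d)$, and $\mathbb R^{V}$ ($V$ the vertex set) is spanned by nonzero subspaces $V_0,\dots,V_d$, where $V_i$ is the space of all vectors on which, for every $1\le j\le d$, the adjacency matrix of the distance-$j$ graph of $A_q(n)$ acts as multiplication by $A_j(i)$. (The distance-$j$ graph has the same vertices, adjacent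 when at distance $j$ in $A_q(n)$.) Moreover, let $1\le j\le d$. Then: (i) $\min_{0\le i\le d}A_j(i)=A_j(d-j+1)$, and this is the smallest eigenvalue of the distance-$j$ graph of $A_q(n)$. (ii) $\max_{1\le i\le d}|A_j(i)|=|A_j(1)|$ if and only if $(q,n,j)\ne(2,4,1)$. (iii) For $0\le i\le d-1$: a) $|A_j(i)|<|A_j(i+1)|$ if and only if $(q,n,i)=(2,2d,d-1)$ and $1\le j\le d-1$; b) $|A_j(i)|=|A_j(i+1)|$ if and only if $(q,n,i)=(2,2d,d-1)$ and $j=d$; c) in all other cases, that is, whenever $(q,n,i)\neq(2,2d,d-1)$, $|A_j(i)|>|A_j(i+1)|$. -/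

import Mathlib

open scoped Matrix

noncomputable section

/-- The Gaussian binomial coefficient with base `b`, for a real `b > 1`. -/
def gaussBinom (b : ℝ) (n m : ℕ) : ℝ :=
  ∏ h ∈ Finset.range m, (b ^ (n - h) - 1) / (b ^ (m - h) - 1)

/-- The number `A_j(i)` attached to the alternating forms graph `A_q(n)`, where `d = ⌊n/2⌋`,
`m = 2n - 2d - 1` and the Gaussian coefficients have base `q²`. It is used for `n ≥ 1` and
`i, j ≤ d` only, where no subtraction truncates in a way that matters
(for `h = j` the exponent `(j - h) * (j - h - 1)` is `0`). -/
def altEigenvalue (q n j i : ℕ) : ℝ :=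
  ∑ h ∈ Finset.range (j + 1),
    (-1 : ℝ) ^ (j - h) * (q : ℝ) ^ ((j - h) * (j - h - 1)) *
      (q : ℝ) ^ (h * (2 * n - 2 * (n / 2) - 1)) *
      gaussBinom ((q : ℝ) ^ 2) (n / 2 - h) (n / 2 - j) *
      gaussBinom ((q : ℝ) ^ 2) (n / 2 - i) h

/-- The skew symmetric `n × n` matrices over `F` with zero diagonal. -/
def altMatrices (F : Type*) [Field F] (n : ℕ) : Submodule F (Matrix (Fin n) (Fin n) F) where
  carrier := {M | Mᵀ = -M ∧ ∀ i, M i i = 0}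
  zero_mem' := by simp
  add_mem' := by
    rintro M N ⟨hM, hM0⟩ ⟨hN, hN0⟩
    refine ⟨?_, fun i => ?_⟩
    · rw [Matrix.transpose_add, hM, hN, neg_add]
    · rw [Matrix.add_apply, hM0, hN0, add_zero]
  smul_mem' := by
    rintro c M ⟨hM, hM0⟩
    refine ⟨?_, fun i => ?_⟩
    · rw [Matrix.transpose_smul, hM, smul_neg]
    · rw [Matrix.smul_apply, hM0, smul_zero]

instance instFintypeAltMatrices (F : Type*) [Field F] [Fintype F] (n : ℕ) :
    Fintype (altMatrices F n) :=
  Fintype.ofFinite _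

/-- The alternating forms graph `A_q(n)`, where `q = |F|`: two skew symmetric matrices with zero
diagonal are adjacent when their difference has rank `2`. -/
def altGraph (F : Type*) [Field F] (n : ℕ) : SimpleGraph (altMatrices F n) where
  Adj X Y := ((X : Matrix (Fin n) (Fin n) F) - (Y : Matrix (Fin n) (Fin n) F)).rank = 2
  symm := ⟨by
    intro X Y h
    rw [← neg_sub, ← neg_one_smul F, 
      Matrix.rank_smul_of_mem_nonZeroDivisors _
        (mem_nonZeroDivisors_of_ne_zero (neg_ne_zero.mpr one_ne_zero))]
    exact h⟩
  loopless := ⟨by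
    intro X h
    simp at h⟩

/-- The distance-`j` graph of `G`: same vertices, two of them being adjacent when they are at
distance `j` in `G`. -/
def distanceGraph {V : Type*} (G : SimpleGraph V) (j : ℕ) : SimpleGraph V where
  Adj x y := x ≠ y ∧ G.edist x y = j
  symm := ⟨by
    rintro x y ⟨h, h'⟩
    exact ⟨h.symm, by rw [SimpleGraph.edist_comm, h']⟩⟩
  loopless := ⟨by
    rintro x ⟨h, -⟩
    exact h rfl⟩

open Classical in
/-- The operator on `ℝ^V` given by the adjacency matrix of the graph `G`. -/
def adjOperator {V : Type*} [Fintype V] (G : SimpleGraph V) : Module.End ℝ (V → ℝ) :=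
  Matrix.toLin' (G.adjMatrix ℝ)

/-- `P` (with rows `i` and columns `j`, `0 ≤ i, j ≤ d`) is the eigenmatrix of the graph `G` of
diameter `d`, with rows in the order of descending eigenvalues of `G`: the joint eigenspaces
`V_0, …, V_d`, on which the adjacency matrix of the distance-`j` graph acts as `P i j`, are nonzero
and span `ℝ^V`. The column `j = 0` belongs to the identity matrix. -/
def IsEigenmatrix {V : Type*} [Fintype V] (G : SimpleGraph V) (d : ℕ) (P : ℕ → ℕ → ℝ) : Prop :=
  G.ediam = d ∧
  (∀ i ≤ d, P i 0 = 1) ∧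
  (∀ i, i + 1 ≤ d → P (i + 1) 1 < P i 1) ∧
  (∀ i ≤ d,
    (⨅ j ∈ Set.Icc 1 d, (adjOperator (distanceGraph G j)).eigenspace (P i j)) ≠ ⊥) ∧
  (⨆ i ∈ Set.Iic d,
    ⨅ j ∈ Set.Icc 1 d, (adjOperator (distanceGraph G j)).eigenspace (P i j)) = ⊤

end

/-! ### Gaussian binomial coefficients -/

section Gauss

variable {b : ℝ}

/-! Write b = q², Q = q^m and A_j(i) for the sum. The proof has two independent halves: inequalities
between the numbers A_j(i), and their identification with the spectrum of the graph.

Inequalities. The sums are studied for a free real parameter Q with b^d ≤ qQ (`altKrawtchouk`).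
Under this condition the absolute values of the terms of A_j(i) increase with h until they vanish
beyond h = min(j, d-i), so the last nonzero term dictates the sign (`altKrawtchouk_sign`). By the
b-Pascal rule, A_j(i) - A_j(i+1) is a positive multiple of a sum of the same kind with d, j, Q
replaced by d-1, j-1, Q/b (`altKrawtchouk_sub_succ`); this is the reason for freeing Q, and it gives
the sign of the difference. The same monotonicity argument applied to A_j(i) + A_j(i+1) gives the
same sign, except possibly when i+1 = d (`altKrawtchouk_add_succ_sign`). Multiplying sum and
difference gives A_j(i)² > A_j(i+1)². In the exceptional case q = 2, n = 2d, i = d-1 only two terms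
survive, and |A_j(d)| - |A_j(d-1)| is a positive multiple of 4^d - 4^j (`abs_altKrawtchouk_last`).
For the extremal statements, A_j(d) is compared with A_j(d-2) rather than with A_j(d-1), so that the
exceptional step is bypassed.

Spectrum. Distance in the graph is half the rank of the difference. Counting pairs (u, v) by the
effect on the rank of Z of subtracting uvᵀ - vuᵀ yields the intersection numbers, hence a three-term
recurrence for the distance matrices (`altDistMatrix_recurrence`). Comparing coefficients shows that
the A_j(i), with i fixed, satisfy the same recurrence (`altKrawtchouk_recurrence`). So the same
polynomials v_j express the distance-j matrix through the adjacency matrix and A_j(i) through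
A_1(i). Both the distance-(d+1) matrix and A_{d+1}(i) vanish; therefore v_{d+1} is a multiple of ∏(X
- A_1(i)) and annihilates the adjacency matrix. Its eigenspaces for the A_1(i) thus span, and none
is zero, because a graph of diameter d admits no annihilating polynomial of degree d. -/

theorem gaussBinom_zero_right (b : ℝ) (n : ℕ) : gaussBinom b n 0 = 1 := by
  simp [gaussBinom]

theorem gaussBinom_succ_succ (b : ℝ) (n m : ℕ) :
    gaussBinom b (n + 1) (m + 1) = (b ^ (n + 1) - 1) / (b ^ (m + 1) - 1) * gaussBinom b n m := by
  simp only [gaussBinom]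
  rw [Finset.prod_range_succ', mul_comm]
  simp

theorem gaussBinom_zero_succ (b : ℝ) (m : ℕ) : gaussBinom b 0 (m + 1) = 0 := by
  simp only [gaussBinom]
  rw [Finset.prod_range_succ']
  simp

theorem gaussBinom_eq_zero (b : ℝ) {n m : ℕ} (h : n < m) : gaussBinom b n m = 0 := by
  induction n generalizing m with
  | zero => obtain ⟨m, rfl⟩ := Nat.exists_eq_add_of_lt h; simpa using gaussBinom_zero_succ b m
  | succ n ih =>
    obtain ⟨m, rfl⟩ : ∃ k, m = k + 1 := ⟨m - 1, by omega⟩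
    rw [gaussBinom_succ_succ, ih (by omega), mul_zero]

theorem pow_succ_sub_one_pos (hb : 1 < b) (k : ℕ) : 0 < b ^ (k + 1) - 1 := by
  have : 1 < b ^ (k + 1) := one_lt_pow₀ hb (Nat.succ_ne_zero k)
  linarith

theorem gaussBinom_pos (hb : 1 < b) {n m : ℕ} (h : m ≤ n) : 0 < gaussBinom b n m := by
  induction n generalizing m with
  | zero =>
    obtain rfl : m = 0 := by omega
    simp [gaussBinom_zero_right]
  | succ n ih =>
    cases m with
    | zero => simp [gaussBinom_zero_right]
    | succ m =>
      rw [gaussBinom_succ_succ]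
      have h1 := pow_succ_sub_one_pos hb n
      have h2 := pow_succ_sub_one_pos hb m
      have h3 := ih (m := m) (by omega)
      positivity

theorem gaussBinom_absorb (hb : 1 < b) (n m : ℕ) :
    (b ^ (m + 1) - 1) * gaussBinom b (n + 1) (m + 1) = (b ^ (n + 1) - 1) * gaussBinom b n m := by
  have := (pow_succ_sub_one_pos hb m).ne'
  rw [gaussBinom_succ_succ]
  field_simp

/-- No bound on k is needed: for k ≥ n the truncated exponent n - k is 0, and both sides vanish. -/
theorem gaussBinom_step (hb : 1 < b) (n k : ℕ) :
    (b ^ (k + 1) - 1) * gaussBinom b n (k + 1) = (b ^ (n - k) - 1) * gaussBinom b n k := by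
  induction n generalizing k with
  | zero => simp [gaussBinom_zero_succ]
  | succ n ih =>
    rw [gaussBinom_absorb hb]
    cases k with
    | zero => simp [gaussBinom_zero_right]
    | succ k =>
      have h1 := ih k
      have h2 := gaussBinom_absorb hb n k
      have h3 := (pow_succ_sub_one_pos hb k).ne'
      apply mul_left_cancel₀ h3
      rw [Nat.add_sub_add_right]
      linear_combination (b ^ (n + 1) - 1) * h1 - (b ^ (n - k) - 1) * h2

theorem gaussBinom_upper (hb : 1 < b) (n k : ℕ) :
    (b ^ (n + 1 - k) - 1) * gaussBinom b (n + 1) k = (b ^ (n + 1) - 1) * gaussBinom b n k := by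
  rw [← gaussBinom_step hb, gaussBinom_absorb hb]

theorem gaussBinom_pascal (hb : 1 < b) (n m : ℕ) :
    gaussBinom b (n + 1) (m + 1) - gaussBinom b n (m + 1) = b ^ (n - m) * gaussBinom b n m := by
  rcases le_or_gt m n with h | h
  · have h1 := gaussBinom_absorb hb n m
    have h2 := gaussBinom_step hb n m
    have h3 := (pow_succ_sub_one_pos hb m).ne'
    apply mul_left_cancel₀ h3
    have h4 : b ^ (n + 1) = b ^ (n - m) * b ^ (m + 1) := by rw [← pow_add]; congr 1; omega
    rw [h4] at h1
    linear_combination h1 - h2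
  · rw [gaussBinom_eq_zero b h, gaussBinom_eq_zero b (by omega : n < m + 1),
      gaussBinom_eq_zero b (by omega : n + 1 < m + 1)]
    simp

/-- The b-factorial form, in which the symmetry m ↔ n - m is visible. -/
theorem gaussBinom_mul_prod (hb : 1 < b) {n m : ℕ} (h : m ≤ n) :
    gaussBinom b n m * ((∏ t ∈ Finset.range m, (b ^ (t + 1) - 1)) *
      ∏ t ∈ Finset.range (n - m), (b ^ (t + 1) - 1)) = ∏ t ∈ Finset.range n, (b ^ (t + 1) - 1) := by
  induction n generalizing m with
  | zero =>
    obtain rfl : m = 0 := by omega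
    simp [gaussBinom_zero_right]
  | succ n ih =>
    cases m with
    | zero => simp [gaussBinom_zero_right]
    | succ m =>
      rw [Nat.add_sub_add_right, Finset.prod_range_succ _ m, Finset.prod_range_succ _ n,
        ← ih (m := m) (by omega)]
      linear_combination (∏ t ∈ Finset.range m, (b ^ (t + 1) - 1)) *
        (∏ t ∈ Finset.range (n - m), (b ^ (t + 1) - 1)) * gaussBinom_absorb hb n m

theorem gaussBinom_symm (hb : 1 < b) {n m : ℕ} (h : m ≤ n) :
    gaussBinom b n (n - m) = gaussBinom b n m := by
  have h1 := gaussBinom_mul_prod hb h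
  have h2 := gaussBinom_mul_prod hb (Nat.sub_le n m)
  rw [Nat.sub_sub_self h] at h2
  have h3 : ∀ k, ∏ t ∈ Finset.range k, (b ^ (t + 1) - 1) ≠ 0 := fun k =>
    Finset.prod_ne_zero_iff.2 fun t _ => (pow_succ_sub_one_pos hb t).ne'
  apply mul_right_cancel₀ (mul_ne_zero (h3 m) (h3 (n - m)))
  rw [h1, ← h2]
  ring

end Gauss

/-! ### The eigenvalues with a free parameter in place of `q ^ m` -/

/-- The unsigned coefficient of `gaussBinom (q ^ 2) (d - i) h` in `altKrawtchouk`. -/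
noncomputable def altKrawtchoukCoeff (q Q : ℝ) (d j h : ℕ) : ℝ :=
  q ^ ((j - h) * (j - h - 1)) * Q ^ h * gaussBinom (q ^ 2) (d - h) (j - h)

/-- The affine `q`-Krawtchouk type sums giving the eigenvalues of the alternating forms graph,
with `Q` in the role of `q ^ m`. -/
noncomputable def altKrawtchouk (q Q : ℝ) (d j i : ℕ) : ℝ :=
  ∑ h ∈ Finset.range (j + 1),
    (-1 : ℝ) ^ (j - h) * (altKrawtchoukCoeff q Q d j h * gaussBinom (q ^ 2) (d - i) h)

theorem altEigenvalue_eq_altKrawtchouk {q n j i : ℕ} (hq : 2 ≤ q) (hj : j ≤ n / 2) :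
    altEigenvalue q n j i =
      altKrawtchouk q ((q : ℝ) ^ (2 * n - 2 * (n / 2) - 1)) (n / 2) j i := by
  unfold altEigenvalue altKrawtchouk altKrawtchoukCoeff
  refine Finset.sum_congr rfl fun h hh => ?_
  have hh : h ≤ j := by simpa [Nat.lt_succ_iff] using hh
  have hb : (1 : ℝ) < (q : ℝ) ^ 2 := one_lt_pow₀ (by exact_mod_cast hq) two_ne_zero
  have : n / 2 - j = n / 2 - h - (j - h) := by omega
  rw [this, gaussBinom_symm hb (by omega : j - h ≤ n / 2 - h), ← pow_mul,
    mul_comm (2 * n - 2 * (n / 2) - 1)]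
  ring

theorem altKrawtchouk_zero (q Q : ℝ) (d i : ℕ) : altKrawtchouk q Q d 0 i = 1 := by
  simp [altKrawtchouk, altKrawtchoukCoeff, gaussBinom_zero_right]

theorem altKrawtchouk_self (q Q : ℝ) (d j : ℕ) :
    altKrawtchouk q Q d j d = (-1) ^ j * altKrawtchoukCoeff q Q d j 0 := by
  unfold altKrawtchouk
  rw [Finset.sum_eq_single 0]
  · simp [gaussBinom_zero_right]
  · intro h _ h0
    rw [Nat.sub_self, gaussBinom_eq_zero _ (Nat.pos_of_ne_zero h0)]
    simp
  · simp

theorem altKrawtchoukCoeff_pos {q Q : ℝ} (hq : 1 < q) (hQ : 0 < Q) {d j h : ℕ} (hjd : j ≤ d) :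
    0 < altKrawtchoukCoeff q Q d j h := by
  have hb : 1 < q ^ 2 := one_lt_pow₀ hq two_ne_zero
  have := gaussBinom_pos hb (by omega : j - h ≤ d - h)
  unfold altKrawtchoukCoeff
  positivity

/-- Comparison of consecutive coefficients. -/
theorem altKrawtchoukCoeff_succ {q Q : ℝ} (hq : 1 < q) {d j h : ℕ} (hhj : h + 1 ≤ j)
    (hjd : j ≤ d) :
    (q ^ 2) ^ (j - h - 1) * ((q ^ 2) ^ (d - h) - 1) * altKrawtchoukCoeff q Q d j (h + 1) =
      ((q ^ 2) ^ (j - h) - 1) * Q * altKrawtchoukCoeff q Q d j h := by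
  have hb : 1 < q ^ 2 := one_lt_pow₀ hq two_ne_zero
  obtain ⟨k, rfl⟩ := Nat.exists_eq_add_of_le hhj
  obtain ⟨l, rfl⟩ := Nat.exists_eq_add_of_le hjd
  unfold altKrawtchoukCoeff
  have e1 : h + 1 + k - h = k + 1 := by omega
  have e2 : h + 1 + k - (h + 1) = k := by omega
  have e3 : h + 1 + k + l - h = k + l + 1 := by omega
  have e4 : h + 1 + k + l - (h + 1) = k + l := by omega
  rw [e1, e2, e3, e4]
  have := gaussBinom_absorb hb (k + l) k
  have e5 : q ^ ((k + 1) * (k + 1 - 1)) = (q ^ 2) ^ k * q ^ (k * (k - 1)) := by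
    rw [← pow_mul, ← pow_add]
    congr 1
    cases k with
    | zero => rfl
    | succ k => simp; ring
  rw [e5, Nat.add_sub_cancel]
  linear_combination -(q ^ 2) ^ k * Q ^ (h + 1) * q ^ (k * (k - 1)) * this

/-- Pascal's rule is applied termwise. The h = 0 terms cancel; apart from Q^h the coefficients
depend only on j - h and d - h, so shifting h lowers j and d by one, and the factor b^(-h) from
Pascal's rule is absorbed into Q / b. -/
theorem altKrawtchouk_sub_succ {q Q : ℝ} (hq : 1 < q) {d j i : ℕ} (hi : i + 1 ≤ d) :
    altKrawtchouk q Q d (j + 1) i - altKrawtchouk q Q d (j + 1) (i + 1) =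
      Q * (q ^ 2) ^ (d - i - 1) * altKrawtchouk q (Q / q ^ 2) (d - 1) j i := by
  have hb : 1 < q ^ 2 := one_lt_pow₀ hq two_ne_zero
  unfold altKrawtchouk
  rw [← Finset.sum_sub_distrib, Finset.sum_range_succ', Finset.mul_sum]
  simp only [gaussBinom_zero_right, sub_self, add_zero]
  refine Finset.sum_congr rfl fun h _ => ?_
  have e1 : d - i = d - i - 1 + 1 := by omega
  have e2 : d - (i + 1) = d - i - 1 := by omega
  have e3 : d - 1 - i = d - i - 1 := by omega
  have hp := gaussBinom_pascal hb (d - i - 1) h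
  have e4 : j + 1 - (h + 1) = j - h := by omega
  have e5 : d - (h + 1) = d - 1 - h := by omega
  rw [e2, e3, ← e1] at *
  unfold altKrawtchoukCoeff
  rw [e4, e5, ← mul_sub, ← mul_sub, hp]
  rcases le_or_gt h (d - i - 1) with hh | hh
  · have e6 : (q ^ 2) ^ (d - i - 1) = (q ^ 2) ^ (d - i - 1 - h) * (q ^ 2) ^ h := by
      rw [← pow_add]; congr 1; omega
    rw [e6, div_pow]
    have : (q ^ 2) ^ h ≠ 0 := by positivity
    generalize q ^ ((j - h) * (j - h - 1)) = z
    generalize (q ^ 2) ^ h = y at *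
    field_simp
    ring
  · rw [gaussBinom_eq_zero _ hh]; ring

/-! ### Alternating sums with increasing terms -/

/-- With S_H for the sum, S_(H+1) = t (H+1) - S_H. The upper bound S_H ≤ t H is what makes the
induction for positivity work. -/
theorem alternating_sum_pos_le {t : ℕ → ℝ} {H : ℕ} (h0 : 0 < t 0)
    (ht : ∀ h < H, t h < t (h + 1)) :
    0 < ∑ h ∈ Finset.range (H + 1), (-1 : ℝ) ^ (H - h) * t h ∧
      ∑ h ∈ Finset.range (H + 1), (-1 : ℝ) ^ (H - h) * t h ≤ t H := by
  induction H with
  | zero => simpa using h0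
  | succ H ih =>
    obtain ⟨h1, h2⟩ := ih fun h hh => ht h (by omega)
    have h3 := ht H (by omega)
    have h4 : ∑ h ∈ Finset.range (H + 1), (-1 : ℝ) ^ (H + 1 - h) * t h =
        -∑ h ∈ Finset.range (H + 1), (-1 : ℝ) ^ (H - h) * t h := by
      rw [← Finset.sum_neg_distrib]
      refine Finset.sum_congr rfl fun h hh => ?_
      have : H + 1 - h = H - h + 1 := by have := Finset.mem_range.1 hh; omega
      rw [this, pow_succ]
      ring
    rw [Finset.sum_range_succ, h4]
    simp only [Nat.sub_self, pow_zero, one_mul]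
    constructor <;> linarith

/-- The sign of an alternating sum whose terms increase until they vanish. -/
theorem alternating_sum_sign {t : ℕ → ℝ} {H j : ℕ} (hH : H ≤ j) (h0 : 0 < t 0)
    (ht : ∀ h < H, t h < t (h + 1)) (hz : ∀ h ≤ j, H < h → t h = 0) :
    0 < (-1 : ℝ) ^ (j - H) * ∑ h ∈ Finset.range (j + 1), (-1 : ℝ) ^ (j - h) * t h := by
  have h1 : ∑ h ∈ Finset.range (j + 1), (-1 : ℝ) ^ (j - h) * t h =
      (-1 : ℝ) ^ (j - H) * ∑ h ∈ Finset.range (H + 1), (-1 : ℝ) ^ (H - h) * t h := by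
    rw [Finset.mul_sum, ← Finset.sum_subset (Finset.range_mono (by omega : H + 1 ≤ j + 1))]
    · refine Finset.sum_congr rfl fun h hh => ?_
      have hh := Finset.mem_range.1 hh
      have : j - h = j - H + (H - h) := by omega
      rw [this, pow_add]
      ring
    · intro h hh hh'
      simp only [Finset.mem_range] at hh hh'
      rw [hz h (by omega) (by omega), mul_zero]
  rw [h1, ← mul_assoc, ← pow_add, Even.neg_one_pow ⟨_, rfl⟩, one_mul]
  exact (alternating_sum_pos_le h0 ht).1

/-! ### Signs -/

section Sign

variable {q Q : ℝ} {d j i : ℕ}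

/-- Terms of the sums increase as soon as the weights `g` do not decrease too fast. -/
theorem altKrawtchoukCoeff_mul_lt (hq : 1 < q) (hQ : 0 < Q) (hjd : j ≤ d) {h : ℕ}
    (hh : h + 1 ≤ j) {x y : ℝ} (hy : 0 ≤ y)
    (hxy : ((q ^ 2) ^ (d - h) - 1) * x < (q ^ 2 - 1) * Q * y) :
    altKrawtchoukCoeff q Q d j h * x < altKrawtchoukCoeff q Q d j (h + 1) * y := by
  have hb : 1 < q ^ 2 := one_lt_pow₀ hq two_ne_zero
  have hp := altKrawtchoukCoeff_pos hq hQ (h := h) hjd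
  have hs := altKrawtchoukCoeff_succ (Q := Q) hq hh hjd
  obtain ⟨k, hk⟩ : ∃ k, j - h = k + 1 := ⟨j - h - 1, by omega⟩
  obtain ⟨e, he⟩ : ∃ e, d - h = e + 1 := ⟨d - h - 1, by omega⟩
  rw [hk, Nat.add_sub_cancel] at hs
  have h1 : 0 < (q ^ 2) ^ (d - h) - 1 := by rw [he]; exact pow_succ_sub_one_pos hb e
  have h2 : 1 ≤ (q ^ 2) ^ k := one_le_pow₀ hb.le
  -- This bounds the ratio of consecutive coefficients below by (b-1)Q / (b^(d-h) - 1), which no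
  -- longer involves j.
  have h3 : (q ^ 2) ^ k * (q ^ 2 - 1) ≤ (q ^ 2) ^ (k + 1) - 1 := by
    rw [pow_succ (q ^ 2) k]; linarith
  set B := (q ^ 2) ^ k
  set D := (q ^ 2) ^ (d - h) - 1
  set C := altKrawtchoukCoeff q Q d j h
  set C' := altKrawtchoukCoeff q Q d j (h + 1)
  have hBD : 0 < B * D := by positivity
  refine lt_of_mul_lt_mul_left ?_ hBD.le
  calc B * D * (C * x) = B * C * (D * x) := by ring
    _ < B * C * ((q ^ 2 - 1) * Q * y) := by gcongr
    _ = (B * (q ^ 2 - 1)) * (Q * C * y) := by ring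
    _ ≤ ((q ^ 2) ^ (k + 1) - 1) * (Q * C * y) := by gcongr
    _ = B * D * (C' * y) := by rw [← mul_assoc, ← mul_assoc, ← hs]; ring

theorem pow_sub_one_mul_lt (hq : 1 < q) {h : ℕ} (hh : h ≤ d) :
    ((q ^ 2) ^ (d - h) - 1) * (q ^ 2) ^ h < (q ^ 2) ^ d := by
  have h1 : (q ^ 2) ^ d = (q ^ 2) ^ (d - h) * (q ^ 2) ^ h := by rw [← pow_add]; congr 1; omega
  have h2 : 0 < (q ^ 2) ^ h := by positivity
  rw [h1]
  nlinarith

theorem pos_of_pow_le_mul (hq : 2 ≤ q) (hQ : (q ^ 2) ^ d ≤ q * Q) : 0 < Q := by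
  have : 0 < (q ^ 2) ^ d := by positivity
  exact pos_of_mul_pos_right (lt_of_lt_of_le this hQ) (by linarith)

/-- By `gaussBinom_step` it suffices that (b^(d-h) - 1)(b^(h+1) - 1) < (b-1)² Q. The left side is
below b·b^d ≤ b·q·Q when h < d, and q³ ≤ (q²-1)² for q ≥ 2 (8 ≤ 9 at q = 2). -/
theorem gaussBinom_weight_lt (hq : 2 ≤ q) (hQ : (q ^ 2) ^ d ≤ q * Q) {e h : ℕ} (hhd : h ≤ d)
    (he : h + 1 ≤ e) :
    ((q ^ 2) ^ (d - h) - 1) * gaussBinom (q ^ 2) e h <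
      (q ^ 2 - 1) * Q * gaussBinom (q ^ 2) e (h + 1) := by
  have hb : 1 < q ^ 2 := by nlinarith
  have h1 := gaussBinom_step hb e h
  have h2 := gaussBinom_pos hb (by omega : h ≤ e)
  have h3 := pow_sub_one_mul_lt (d := d) (by linarith : 1 < q) hhd
  have h4 := pow_succ_sub_one_pos hb h
  obtain ⟨r, rfl⟩ := Nat.exists_eq_add_of_le he
  have e1 : h + 1 + r - h = r + 1 := by omega
  rw [e1] at h1
  have h5 : q ^ 2 - 1 ≤ (q ^ 2) ^ (r + 1) - 1 := by
    have : q ^ 2 ≤ (q ^ 2) ^ (r + 1) := le_self_pow₀ hb.le (Nat.succ_ne_zero r)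
    linarith
  have hQ0 := pos_of_pow_le_mul hq hQ
  set D := (q ^ 2) ^ (d - h) - 1
  set g := gaussBinom (q ^ 2) (h + 1 + r) h
  set g' := gaussBinom (q ^ 2) (h + 1 + r) (h + 1)
  set x := (q ^ 2) ^ h
  have hx : 0 < x := by positivity
  have h6 : D * x < q * Q := lt_of_lt_of_le h3 hQ
  have h7 : (q ^ 2) ^ (h + 1) = x * q ^ 2 := pow_succ _ _
  have h8 : q ^ 2 * q ≤ (q ^ 2 - 1) * (q ^ 2 - 1) := by
    nlinarith [mul_nonneg (by linarith : (0:ℝ) ≤ q - 2) (by nlinarith : (0:ℝ) ≤ q ^ 3 + q ^ 2)]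
  rw [h7] at h1 h4
  have hg' : (q ^ 2 - 1) * g ≤ (x * q ^ 2 - 1) * g' := by rw [h1]; gcongr
  refine lt_of_mul_lt_mul_left ?_ h4.le
  -- D = 0 occurs for h = d, where the chain of estimates would lose its strictness.
  rcases le_or_gt D 0 with hD | hD
  · have : 0 < g' := gaussBinom_pos hb (by omega)
    have h9 : 0 < (x * q ^ 2 - 1) * ((q ^ 2 - 1) * Q * g') := by
      have : 0 < q ^ 2 - 1 := by linarith
      positivity
    refine lt_of_le_of_lt ?_ h9
    rw [← mul_assoc]
    refine mul_nonpos_of_nonpos_of_nonneg ?_ h2.le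
    nlinarith
  calc (x * q ^ 2 - 1) * (D * g) ≤ (x * q ^ 2) * (D * g) := by gcongr; linarith
    _ = q ^ 2 * (D * x) * g := by ring
    _ < q ^ 2 * (q * Q) * g := by gcongr
    _ = (q ^ 2 * q) * (Q * g) := by ring
    _ ≤ (q ^ 2 - 1) * (q ^ 2 - 1) * (Q * g) := by gcongr
    _ = (q ^ 2 - 1) * Q * ((q ^ 2 - 1) * g) := by ring
    _ ≤ (q ^ 2 - 1) * Q * ((x * q ^ 2 - 1) * g') := by
      have : 0 < q ^ 2 - 1 := by linarith
      gcongr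
    _ = _ := by ring

/-- Used with x = b^h and y = b^(e-h). The alternatives exclude x = y = 1, where the inequality
reduces to 2q ≤ q² - 1 and fails for q = 2: this is the origin of the exceptional case. -/
theorem weight_sum_poly_ineq {x y : ℝ} (hq : 2 ≤ q) (hx : 1 ≤ x) (hy : 1 ≤ y)
    (h : (q ^ 2 ≤ x ∧ y = 1) ∨ q ^ 2 ≤ y) :
    q * (q ^ 2 * x * y + q ^ 2 * y - 2) * (q ^ 2 * x - 1) ≤
      (q ^ 2 - 1) * (q ^ 2 * x * y + y - 2) * (q ^ 2 * y - 1) * x := by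
  obtain ⟨b, hbq⟩ : ∃ b, q ^ 2 = b := ⟨_, rfl⟩
  have hb : 4 ≤ b := by nlinarith
  have hbq2 : 2 * q ≤ b := by nlinarith
  rw [hbq] at h ⊢
  rcases h with ⟨h, rfl⟩ | h
  · have h1 : q * (b * x + b - 2) ≤ (b - 1) ^ 2 * x := by
      have h2 : b + 2 ≤ q * (b - 1) := by nlinarith
      have h4 : q * (b + 2) ≤ b * (b - 1) := by
        calc q * (b + 2) ≤ q * (q * (b - 1)) := by gcongr
          _ = b * (b - 1) := by rw [← hbq]; ring
      have h5 : 0 ≤ (b - 1) ^ 2 - q * b := by nlinarith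
      nlinarith [mul_nonneg h5 (by linarith : 0 ≤ x - b)]
    have h0 : 0 ≤ b * x - 1 := by nlinarith
    calc _ = q * (b * x + b - 2) * (b * x - 1) := by ring
      _ ≤ (b - 1) ^ 2 * x * (b * x - 1) := by gcongr
      _ = _ := by ring
  · have hxy : y ≤ x * y := by nlinarith
    have hbxy : 4 * y ≤ b * x * y := by
      nlinarith [mul_nonneg (by linarith : 0 ≤ b - 4) (by positivity : 0 ≤ x * y)]
    have h1 : b * x * y + b * y - 2 ≤ 2 * (b * x * y + y - 2) := by nlinarith
    have h2 : 2 * q * b ≤ (b - 1) * (b * y - 1) := by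
      have : b * b ≤ (b - 1) * (b * b - 1) := by nlinarith
      have h3 : (b - 1) * (b * b - 1) ≤ (b - 1) * (b * y - 1) := by
        have : 0 ≤ b - 1 := by linarith
        gcongr
      nlinarith
    have h0 : 0 ≤ b * x * y + y - 2 := by linarith
    calc q * (b * x * y + b * y - 2) * (b * x - 1)
        ≤ q * (2 * (b * x * y + y - 2)) * (b * x) := by
          have : 0 ≤ b * x - 1 := by nlinarith
          gcongr
          linarith
      _ = 2 * q * b * ((b * x * y + y - 2) * x) := by ring
      _ ≤ (b - 1) * (b * y - 1) * ((b * x * y + y - 2) * x) := by gcongr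
      _ = _ := by ring

/-- Both sums of weights are rational multiples of [e, h], so after inserting b^(d-h) - 1 < qQ / b^h
only `weight_sum_poly_ineq` remains. For e = 0 the claim is literally the second alternative of the
hypothesis. -/
theorem gaussBinom_add_weight_lt (hq : 2 ≤ q) (hQ : (q ^ 2) ^ d ≤ q * Q) {e h : ℕ} (hhd : h ≤ d)
    (he : h ≤ e) (hex : e ≠ 0 ∨ 2 * ((q ^ 2) ^ d - 1) < (q ^ 2 - 1) * Q) :
    ((q ^ 2) ^ (d - h) - 1) * (gaussBinom (q ^ 2) (e + 1) h + gaussBinom (q ^ 2) e h) <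
      (q ^ 2 - 1) * Q *
        (gaussBinom (q ^ 2) (e + 1) (h + 1) + gaussBinom (q ^ 2) e (h + 1)) := by
  have hb : 1 < q ^ 2 := by nlinarith
  by_cases he0 : e = 0
  · subst he0
    obtain rfl : h = 0 := by omega
    have h1 := hex.resolve_left (by simp)
    have h2 : gaussBinom (q ^ 2) 1 1 = 1 := by
      have := gaussBinom_succ_succ (q ^ 2) 0 0
      rw [this, gaussBinom_zero_right, mul_one, div_self]
      exact (pow_succ_sub_one_pos hb 0).ne'
    simp only [zero_add, gaussBinom_zero_right, h2, gaussBinom_zero_succ (q ^ 2) 0]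
    simpa [mul_comm, one_add_one_eq_two] using h1
  have hQ0 := pos_of_pow_le_mul hq hQ
  obtain ⟨r, rfl⟩ := Nat.exists_eq_add_of_le he
  have h1 := gaussBinom_upper hb (h + r) h
  have h2 := gaussBinom_absorb hb (h + r) h
  have h3 := gaussBinom_step hb (h + r) h
  have h4 := pow_sub_one_mul_lt (d := d) (by linarith : 1 < q) hhd
  have e1 : h + r + 1 - h = r + 1 := by omega
  have e2 : h + r - h = r := by omega
  have g0 := gaussBinom_pos hb (by omega : h ≤ h + r)
  have hA := pow_succ_sub_one_pos hb h
  have hB := pow_succ_sub_one_pos hb r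
  have hx : 1 ≤ (q ^ 2) ^ h := one_le_pow₀ hb.le
  have hy : 1 ≤ (q ^ 2) ^ r := one_le_pow₀ hb.le
  rw [e1] at h1
  rw [e2] at h3
  have hxy : (q ^ 2 ≤ (q ^ 2) ^ h ∧ (q ^ 2) ^ r = 1) ∨ q ^ 2 ≤ (q ^ 2) ^ r := by
    by_cases hr : r = 0
    · subst hr
      exact Or.inl ⟨le_self_pow₀ hb.le (by omega), pow_zero _⟩
    · exact Or.inr (le_self_pow₀ hb.le hr)
  have key := weight_sum_poly_ineq hq hx hy hxy
  have e3 : (q ^ 2) ^ (h + r + 1) = q ^ 2 * (q ^ 2) ^ h * (q ^ 2) ^ r := by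
    rw [pow_succ _ (h + r), pow_add]; ring
  rw [e3] at h1 h2
  rw [pow_succ' _ r] at h1 hB
  rw [pow_succ' _ h] at h2 h3 hA
  generalize gaussBinom (q ^ 2) (h + r) h = g at *
  generalize gaussBinom (q ^ 2) (h + r) (h + 1) = g3 at *
  generalize gaussBinom (q ^ 2) (h + r + 1) (h + 1) = g2 at *
  generalize gaussBinom (q ^ 2) (h + r + 1) h = g1 at *
  generalize (q ^ 2) ^ (d - h) - 1 = D at *
  generalize (q ^ 2) ^ h = x at *
  generalize (q ^ 2) ^ r = y at *
  generalize (q ^ 2) ^ d = E at *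
  have hx0 : 0 < x := by linarith
  have hxy1 : 1 ≤ x * y := one_le_mul_of_one_le_of_one_le hx hy
  have hpos : 0 < q ^ 2 * x * y + q ^ 2 * y - 2 := by nlinarith
  have s1 : (q ^ 2 * y - 1) * (g1 + g) = (q ^ 2 * x * y + q ^ 2 * y - 2) * g := by
    linear_combination h1
  have s2 : (q ^ 2 * x - 1) * (g2 + g3) = (q ^ 2 * x * y + y - 2) * g := by
    linear_combination h2 + h3
  have hDx : D * x < q * Q := lt_of_lt_of_le h4 hQ
  have hpp : 0 < (q ^ 2 * y - 1) * (q ^ 2 * x - 1) * x := by positivity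
  refine lt_of_mul_lt_mul_left ?_ hpp.le
  calc (q ^ 2 * y - 1) * (q ^ 2 * x - 1) * x * (D * (g1 + g))
      = (D * x) * ((q ^ 2 * x - 1) * ((q ^ 2 * y - 1) * (g1 + g))) := by ring
    _ = (D * x) * ((q ^ 2 * x - 1) * ((q ^ 2 * x * y + q ^ 2 * y - 2) * g)) := by rw [s1]
    _ < (q * Q) * ((q ^ 2 * x - 1) * ((q ^ 2 * x * y + q ^ 2 * y - 2) * g)) := by gcongr
    _ = q * (q ^ 2 * x * y + q ^ 2 * y - 2) * (q ^ 2 * x - 1) * (Q * g) := by ring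
    _ ≤ (q ^ 2 - 1) * (q ^ 2 * x * y + y - 2) * (q ^ 2 * y - 1) * x * (Q * g) := by gcongr
    _ = (q ^ 2 - 1) * Q * (q ^ 2 * y - 1) * x * ((q ^ 2 * x * y + y - 2) * g) := by ring
    _ = _ := by rw [← s2]; ring

theorem altKrawtchouk_sign (hq : 2 ≤ q) (hQ : (q ^ 2) ^ d ≤ q * Q) (hjd : j ≤ d) :
    0 < (-1 : ℝ) ^ (j - min j (d - i)) * altKrawtchouk q Q d j i := by
  have hq1 : 1 < q := by linarith
  have hb : 1 < q ^ 2 := by nlinarith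
  have hQ0 := pos_of_pow_le_mul hq hQ
  refine alternating_sum_sign (min_le_left _ _) ?_ (fun h hh => ?_) (fun h hh hh' => ?_)
  · rw [gaussBinom_zero_right, mul_one]
    exact altKrawtchoukCoeff_pos hq1 hQ0 hjd
  · have hh := lt_min_iff.1 hh
    exact altKrawtchoukCoeff_mul_lt hq1 hQ0 hjd hh.1 (gaussBinom_pos hb hh.2).le
      (gaussBinom_weight_lt hq hQ (by omega) hh.2)
  · rw [gaussBinom_eq_zero, mul_zero]
    rcases min_lt_iff.1 hh' with h1 | h1 <;> omega

/-- The two sums share their coefficients, so their total is again an alternating sum of the same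
type, with weights [d-i, h] + [d-i-1, h]; its terms still increase up to h = min(j, d-i). -/
theorem altKrawtchouk_add_succ_sign (hq : 2 ≤ q) (hQ : (q ^ 2) ^ d ≤ q * Q) (hjd : j ≤ d)
    (hi : i + 1 ≤ d) (hex : i + 1 ≠ d ∨ 2 * ((q ^ 2) ^ d - 1) < (q ^ 2 - 1) * Q) :
    0 < (-1 : ℝ) ^ (j - min j (d - i)) *
      (altKrawtchouk q Q d j i + altKrawtchouk q Q d j (i + 1)) := by
  have hq1 : 1 < q := by linarith
  have hb : 1 < q ^ 2 := by nlinarith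
  have hQ0 := pos_of_pow_le_mul hq hQ
  obtain ⟨e, he⟩ : ∃ e, d - i = e + 1 := ⟨d - i - 1, by omega⟩
  have he' : d - (i + 1) = e := by omega
  unfold altKrawtchouk
  rw [← Finset.sum_add_distrib, he, he']
  simp only [← mul_add]
  refine alternating_sum_sign (min_le_left _ _) ?_ (fun h hh => ?_) (fun h hh hh' => ?_)
  · rw [gaussBinom_zero_right, gaussBinom_zero_right]
    have := altKrawtchoukCoeff_pos hq1 hQ0 (h := 0) hjd
    linarith
  · have hh := lt_min_iff.1 hh
    refine altKrawtchoukCoeff_mul_lt hq1 hQ0 hjd hh.1 ?_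
      (gaussBinom_add_weight_lt hq hQ (by omega) (by omega) (hex.imp_left (by omega)))
    have h1 := gaussBinom_pos hb hh.2
    rcases le_or_gt (h + 1) e with h2 | h2
    · exact (add_pos h1 (gaussBinom_pos hb h2)).le
    · rw [gaussBinom_eq_zero _ h2, add_zero]
      exact h1.le
  · rw [gaussBinom_eq_zero, gaussBinom_eq_zero, add_zero, mul_zero] <;>
    rcases min_lt_iff.1 hh' with h1 | h1 <;> omega

theorem pow_pred_le_mul_div (hq : 2 ≤ q) (hQ : (q ^ 2) ^ d ≤ q * Q) (hd : 1 ≤ d) :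
    (q ^ 2) ^ (d - 1) ≤ q * (Q / q ^ 2) := by
  obtain ⟨e, rfl⟩ : ∃ e, d = e + 1 := ⟨d - 1, by omega⟩
  rw [← mul_div_assoc, le_div_iff₀ (by positivity), Nat.add_sub_cancel, ← pow_succ]
  exact hQ

theorem altKrawtchouk_sub_succ_sign (hq : 2 ≤ q) (hQ : (q ^ 2) ^ d ≤ q * Q) (hj : 1 ≤ j)
    (hjd : j ≤ d) (hi : i + 1 ≤ d) :
    0 < (-1 : ℝ) ^ (j - min j (d - i)) *
      (altKrawtchouk q Q d j i - altKrawtchouk q Q d j (i + 1)) := by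
  obtain ⟨k, rfl⟩ : ∃ k, j = k + 1 := ⟨j - 1, by omega⟩
  rw [altKrawtchouk_sub_succ (by linarith) hi]
  have h1 := altKrawtchouk_sign (i := i) hq (pow_pred_le_mul_div hq hQ (by omega))
    (by omega : k ≤ d - 1)
  have hQ0 := pos_of_pow_le_mul hq hQ
  have e1 : k + 1 - min (k + 1) (d - i) = k - min k (d - 1 - i) := by omega
  rw [e1, mul_left_comm]
  positivity

/-- Sum and difference of the two values have the same sign, so their product, the difference of the
squares, is positive. -/
theorem abs_altKrawtchouk_succ_lt (hq : 2 ≤ q) (hQ : (q ^ 2) ^ d ≤ q * Q) (hj : 1 ≤ j)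
    (hjd : j ≤ d) (hi : i + 1 ≤ d)
    (hex : i + 1 ≠ d ∨ 2 * ((q ^ 2) ^ d - 1) < (q ^ 2 - 1) * Q) :
    |altKrawtchouk q Q d j (i + 1)| < |altKrawtchouk q Q d j i| := by
  have h1 := altKrawtchouk_add_succ_sign hq hQ hjd hi hex
  have h2 := altKrawtchouk_sub_succ_sign hq hQ hj hjd hi
  rw [← sq_lt_sq]
  have h3 := mul_pos h1 h2
  rw [mul_mul_mul_comm, ← pow_add, Even.neg_one_pow ⟨_, rfl⟩, one_mul] at h3
  linarith

/-- The exceptional case: comparison of the last two eigenvalues. -/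
theorem abs_altKrawtchouk_last (hQ : 2 * Q = 4 ^ d) (hj : 1 ≤ j) (hjd : j ≤ d) {i : ℕ}
    (hi : i + 1 = d) :
    ∃ u : ℝ, 0 < u ∧ |altKrawtchouk 2 Q d j d| - |altKrawtchouk 2 Q d j i| =
      u * ((4 : ℝ) ^ d - 4 ^ j) := by
  have hQ0 : 0 < Q := by have : (0 : ℝ) < 4 ^ d := by positivity
                         linarith
  have h1 := altKrawtchouk_sign (q := 2) (Q := Q) (i := i) le_rfl (by norm_num; linarith) hjd
  have h2 := altKrawtchouk_sign (q := 2) (Q := Q) (i := d) le_rfl (by norm_num; linarith) hjd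
  have h3 := altKrawtchoukCoeff_succ (q := 2) (Q := Q) (h := 0) (by norm_num) hj hjd
  have h4 := altKrawtchoukCoeff_pos (q := 2) (Q := Q) (h := 0) (by norm_num) hQ0 hjd
  have h5 : altKrawtchouk 2 Q d j i =
      (-1) ^ j * altKrawtchoukCoeff 2 Q d j 0 + (-1) ^ (j - 1) * altKrawtchoukCoeff 2 Q d j 1 := by
    have hdi : d - i = 1 := by omega
    unfold altKrawtchouk
    rw [← Finset.sum_subset (Finset.range_mono (by omega : 2 ≤ j + 1))]
    · have := gaussBinom_succ_succ ((2 : ℝ) ^ 2) 0 0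
      rw [gaussBinom_zero_right, zero_add, pow_one, mul_one, div_self (by norm_num)] at this
      simp [Finset.sum_range_succ, hdi, gaussBinom_zero_right, this]
    · intro h _ hh
      rw [gaussBinom_eq_zero, mul_zero, mul_zero]
      simp only [Finset.mem_range] at hh
      omega
  have h6 := altKrawtchouk_self 2 Q d j
  have habs : ∀ (k : ℕ) (x : ℝ), 0 < (-1 : ℝ) ^ k * x → |x| = (-1 : ℝ) ^ k * x := by
    intro k x hx
    rw [← abs_of_pos hx, abs_mul, abs_pow]
    simp
  have hs : (-1 : ℝ) ^ (j - 1) * (-1) ^ (j - 1) = 1 := by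
    rw [← pow_add, Even.neg_one_pow ⟨_, rfl⟩]
  have hj' : (-1 : ℝ) ^ j = -(-1) ^ (j - 1) := by
    obtain ⟨k, rfl⟩ : ∃ k, j = k + 1 := ⟨j - 1, by omega⟩
    rw [Nat.add_sub_cancel, pow_succ]
    ring
  have e1 : min j (d - d) = 0 := by omega
  have e2 : min j (d - i) = 1 := by omega
  rw [habs _ _ h1, habs _ _ h2, h5, h6, e1, e2, Nat.sub_zero, hj']
  obtain ⟨k, rfl⟩ : ∃ k, j = k + 1 := ⟨j - 1, by omega⟩
  obtain ⟨e, rfl⟩ : ∃ e, d = e + 1 := ⟨d - 1, by omega⟩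
  simp only [Nat.sub_zero, Nat.add_sub_cancel, zero_add] at *
  norm_num at h3
  have hE : (0 : ℝ) < 4 ^ (e + 1) - 1 := pow_succ_sub_one_pos (by norm_num) e
  have hK : (0 : ℝ) < 4 ^ k := by positivity
  -- With C₀, C₁ the first two coefficients, the absolute values are C₀ and C₁ - C₀, so the
  -- difference is 2C₀ - C₁. Substituting `h3`, which gives C₁ in terms of C₀, and Q = 4^d / 2
  -- produces this factor.
  refine ⟨altKrawtchoukCoeff 2 Q (e + 1) (k + 1) 0 / (2 * 4 ^ k * (4 ^ (e + 1) - 1)),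
    by positivity, ?_⟩
  rw [div_mul_eq_mul_div, eq_div_iff (by positivity)]
  have hQ' : Q = 4 ^ (e + 1) / 2 := by linarith
  rw [hQ'] at h3 ⊢
  rw [pow_succ _ k] at *
  linear_combination (2 * 4 ^ k * (4 ^ (e + 1) - 1)) *
    (2 * altKrawtchoukCoeff 2 (4 ^ (e + 1) / 2) (e + 1) (k + 1) 0 -
      altKrawtchoukCoeff 2 (4 ^ (e + 1) / 2) (e + 1) (k + 1) 1) * hs - 2 * h3

/-- Two steps before the last eigenvalue the gap is still larger than the last eigenvalue. -/
theorem altKrawtchouk_sub_last_sign (hq : 2 ≤ q) (hQ : (q ^ 2) ^ d ≤ q * Q) (hj : 2 ≤ j)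
    (hjd : j ≤ d) {i : ℕ} (hi : i + 2 = d) :
    0 < (-1 : ℝ) ^ j * (altKrawtchouk q Q d j i - altKrawtchouk q Q d j d) := by
  have hq1 : 1 < q := by linarith
  have hb : 1 < q ^ 2 := by nlinarith
  have hQ0 := pos_of_pow_le_mul hq hQ
  have hdi : d - i = 2 := by omega
  -- The value at d is exactly the h = 0 term, so only h = 1 and h = 2 remain, and the latter
  -- dominates.
  have h1 : altKrawtchouk q Q d j i - altKrawtchouk q Q d j d =
      (-1) ^ (j - 1) * (altKrawtchoukCoeff q Q d j 1 * gaussBinom (q ^ 2) 2 1) +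
        (-1) ^ (j - 2) * (altKrawtchoukCoeff q Q d j 2 * gaussBinom (q ^ 2) 2 2) := by
    rw [altKrawtchouk_self]
    unfold altKrawtchouk
    rw [← Finset.sum_subset (Finset.range_mono (by omega : 3 ≤ j + 1))]
    · simp only [Finset.sum_range_succ, hdi, gaussBinom_zero_right, Finset.sum_range_zero]
      simp only [Nat.sub_zero]
      ring
    · intro h _ hh
      rw [gaussBinom_eq_zero, mul_zero, mul_zero]
      simp only [Finset.mem_range] at hh
      omega
  have h2 := altKrawtchoukCoeff_mul_lt hq1 hQ0 hjd (h := 1) hj (gaussBinom_pos hb le_rfl).le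
    (gaussBinom_weight_lt hq hQ (by omega) le_rfl)
  obtain ⟨k, rfl⟩ : ∃ k, j = k + 2 := ⟨j - 2, by omega⟩
  rw [h1, Nat.add_sub_cancel, show k + 2 - 1 = k + 1 from rfl, pow_add _ k 2, pow_succ _ k]
  have hs : (-1 : ℝ) ^ k * (-1) ^ k = 1 := by rw [← pow_add, Even.neg_one_pow ⟨_, rfl⟩]
  have h3 : (-1 : ℝ) ^ k * (-1) ^ 2 *
      ((-1) ^ k * -1 * (altKrawtchoukCoeff q Q d (k + 2) 1 * gaussBinom (q ^ 2) 2 1) +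
        (-1) ^ k * (altKrawtchoukCoeff q Q d (k + 2) 2 * gaussBinom (q ^ 2) 2 2)) =
      altKrawtchoukCoeff q Q d (k + 2) 2 * gaussBinom (q ^ 2) 2 2 -
        altKrawtchoukCoeff q Q d (k + 2) 1 * gaussBinom (q ^ 2) 2 1 := by
    linear_combination (altKrawtchoukCoeff q Q d (k + 2) 2 * gaussBinom (q ^ 2) 2 2 -
        altKrawtchoukCoeff q Q d (k + 2) 1 * gaussBinom (q ^ 2) 2 1) * hs
  rw [h3]
  linarith

end Sign

/-! ### The three-term recurrence -/

section Recurrence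

variable {q Q : ℝ} {d j i : ℕ}

/-- The signed coefficients of `altKrawtchouk`, without the powers of `Q`. -/
noncomputable def altSignedCoeff (q : ℝ) (d j h : ℕ) : ℝ :=
  if h ≤ j then
    (-1 : ℝ) ^ (j - h) * q ^ ((j - h) * (j - h - 1)) * gaussBinom (q ^ 2) (d - h) (j - h)
  else 0

theorem altKrawtchouk_eq_sum {N : ℕ} (hN : j + 1 ≤ N) :
    altKrawtchouk q Q d j i = ∑ h ∈ Finset.range N,
      altSignedCoeff q d j h * (Q ^ h * gaussBinom (q ^ 2) (d - i) h) := by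
  unfold altKrawtchouk
  rw [← Finset.sum_subset (Finset.range_mono hN)]
  · refine Finset.sum_congr rfl fun h hh => ?_
    have hh := Finset.mem_range.1 hh
    rw [altSignedCoeff, if_pos (by omega), altKrawtchoukCoeff]
    ring
  · intro h _ hh
    simp only [Finset.mem_range] at hh
    rw [altSignedCoeff, if_neg (by omega), zero_mul]

theorem altKrawtchouk_eq_zero (i : ℕ) : altKrawtchouk q Q d (d + 1) i = 0 := by
  unfold altKrawtchouk
  refine Finset.sum_eq_zero fun h hh => ?_
  have hh := Finset.mem_range.1 hh
  rcases le_or_gt h d with h1 | h1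
  · rw [altKrawtchoukCoeff, gaussBinom_eq_zero _ (by omega : d - h < d + 1 - h)]
    ring
  -- For h = d + 1 truncation turns the Gaussian coefficient inside `altKrawtchoukCoeff` into 1;
  -- here it is the weight that vanishes.
  · rw [gaussBinom_eq_zero _ (by omega : d - i < h)]
    ring

theorem neg_one_pow_mul_pow_succ (q : ℝ) (k : ℕ) :
    (-1 : ℝ) ^ (k + 1) * q ^ ((k + 1) * (k + 1 - 1)) =
      -(q ^ 2) ^ k * ((-1) ^ k * q ^ (k * (k - 1))) := by
  have : q ^ ((k + 1) * (k + 1 - 1)) = (q ^ 2) ^ k * q ^ (k * (k - 1)) := by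
    rw [← pow_mul, ← pow_add]
    congr 1
    cases k with
    | zero => rfl
    | succ k => simp; ring
  rw [this, pow_succ]
  ring

/-- The coefficient identity behind the recurrence, in the generic range. -/
theorem altSignedCoeff_generic (hq : 1 < q) {h k l : ℕ} :
    let D := h + k + 1 + l
    let b := q ^ 2
    altSignedCoeff q D (h + k + 1) h * ((b ^ h - 1) * Q - (b ^ D - 1)) -
        (Q - b ^ (h + k)) * (b ^ D - b ^ (h + k)) * altSignedCoeff q D (h + k) h -
        ((Q - 1) * (b ^ D - 1) - (Q - b ^ (h + k + 1)) * (b ^ D - b ^ (h + k + 1)) -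
          (b ^ (h + k + 1) - 1) * b ^ (h + k)) * altSignedCoeff q D (h + k + 1) h -
        (b ^ (h + k + 2) - 1) * b ^ (h + k + 1) * altSignedCoeff q D (h + k + 2) h =
      (b ^ h - 1) * (b ^ (k + 1) * (-1) ^ (k + 1) * q ^ ((k + 1) * k) *
        ((b ^ (k + 1 + l + 1) - 1) / (b ^ (k + 2) - 1)) * b ^ h / b *
          gaussBinom b (k + 1 + l) (k + 1)) := by
  intro D b
  have hb : 1 < b := one_lt_pow₀ hq two_ne_zero
  have hb0 : b ≠ 0 := by positivity
  have e1 : D - h = k + 1 + l := by omega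
  have e2 : h + k + 1 - h = k + 1 := by omega
  have e3 : h + k - h = k := by omega
  have e4 : h + k + 2 - h = k + 2 := by omega
  unfold altSignedCoeff
  rw [if_pos (by omega), if_pos (by omega), if_pos (by omega), e1, e2, e3, e4,
    neg_one_pow_mul_pow_succ q (k + 1), neg_one_pow_mul_pow_succ q k]
  have hk : (-1 : ℝ) ^ (k + 1) * q ^ ((k + 1) * k) = -b ^ k * ((-1) ^ k * q ^ (k * (k - 1))) := by
    have := neg_one_pow_mul_pow_succ q k
    rwa [Nat.add_sub_cancel] at this
  rw [mul_assoc (b ^ (k + 1)), hk]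
  have g1 := gaussBinom_step hb (k + 1 + l) k
  have g2 := gaussBinom_step hb (k + 1 + l) (k + 1)
  have f1 : k + 1 + l - k = l + 1 := by omega
  have f2 : k + 1 + l - (k + 1) = l := by omega
  rw [f1] at g1
  rw [f2] at g2
  have p1 := (pow_succ_sub_one_pos hb l).ne'
  have p2 := (pow_succ_sub_one_pos hb (k + 1)).ne'
  -- Everything is expressed through the single coefficient [k+1+l, k+1]; what is left is a rational
  -- identity in b, Q and the powers b^h, b^k, b^l.
  have g1' : gaussBinom b (k + 1 + l) k =
      (b ^ (k + 1) - 1) / (b ^ (l + 1) - 1) * gaussBinom b (k + 1 + l) (k + 1) := by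
    field_simp
    linear_combination -g1
  have g2' : gaussBinom b (k + 1 + l) (k + 2) =
      (b ^ l - 1) / (b ^ (k + 2) - 1) * gaussBinom b (k + 1 + l) (k + 1) := by
    rw [show k + 2 = k + 1 + 1 from rfl]
    field_simp
    linear_combination g2
  change _ * gaussBinom b _ _ * _ - _ * (_ * gaussBinom b _ _) - _ * (_ * gaussBinom b _ _) -
    _ * (_ * gaussBinom b _ _) = _
  rw [g1', g2']
  change -b ^ k * _ * _ * _ - _ - _ * (-b ^ k * _ * _) - _ * (-b ^ (k + 1) * (-b ^ k * _) * _) = _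
  generalize gaussBinom b (k + 1 + l) (k + 1) = g
  generalize (-1) ^ k * q ^ (k * (k - 1)) = s
  have z1 : b ^ D = b ^ h * b ^ k * b * b ^ l := by rw [← pow_add, ← pow_succ, ← pow_add]
  have z2 : b ^ (h + k + 1) = b ^ h * b ^ k * b := by rw [pow_succ, pow_add]
  have z3 : b ^ (h + k) = b ^ h * b ^ k := pow_add _ _ _
  have z4 : b ^ (h + k + 2) = b ^ h * b ^ k * b * b := by rw [pow_succ, z2]
  have z5 : b ^ (k + 1 + l + 1) = b ^ k * b * b ^ l * b := by rw [pow_succ, pow_add, pow_succ]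
  have z6 : b ^ (k + 2) = b ^ k * b * b := by rw [pow_succ, pow_succ]
  have z7 : b ^ (k + 1) = b ^ k * b := pow_succ _ _
  have z8 : b ^ (l + 1) = b ^ l * b := pow_succ _ _
  rw [show k + 1 + 1 = k + 2 from rfl] at p2
  rw [z6] at p2
  rw [z8] at p1
  rw [z1, z2, z3, z4, z5, z6, z7, z8]
  clear_value b
  clear g1 g2 g1' g2' z1 z2 z3 z4 z5 z6 z7 z8 hk
  generalize b ^ h = x
  generalize b ^ k = y at *
  generalize b ^ l = z at *
  have p1' : b * z - 1 ≠ 0 := by rwa [mul_comm]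
  have p2' : y * b ^ 2 - 1 ≠ 0 := by rwa [pow_two, ← mul_assoc]
  field_simp
  ring

theorem altSignedCoeff_self (q : ℝ) (d j : ℕ) : altSignedCoeff q d j j = 1 := by
  simp [altSignedCoeff, gaussBinom_zero_right]

theorem altSignedCoeff_of_lt (q : ℝ) (d : ℕ) {j h : ℕ} (hh : j < h) :
    altSignedCoeff q d j h = 0 := if_neg (by omega)

theorem altSignedCoeff_succ_self (hq : 1 < q) (d j : ℕ) :
    (q ^ 2 - 1) * altSignedCoeff q d (j + 1) j = -((q ^ 2) ^ (d - j) - 1) := by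
  have hb : 1 < q ^ 2 := one_lt_pow₀ hq two_ne_zero
  have := gaussBinom_step hb (d - j) 0
  rw [gaussBinom_zero_right, zero_add, pow_one] at this
  have e : j + 1 - j = 1 := by omega
  rw [altSignedCoeff, if_pos (by omega), e]
  simp only [Nat.sub_self, mul_zero, pow_zero, pow_one, Nat.sub_zero] at *
  linarith

/-- Identifies the right side of `altSignedCoeff_generic` at h + 1 with the contribution of the
preceding index. The explicit form there avoids h - 1, so that it also covers h = 0, where the
factor b^h - 1 kills it. -/
theorem altSignedCoeff_shift (hq : 1 < q) (h k l : ℕ) :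
    altSignedCoeff q (h + 1 + k + 1 + l) (h + 1 + k + 1) h * (q ^ 2) ^ h =
      -((q ^ 2) ^ (k + 1) * (-1) ^ (k + 1) * q ^ ((k + 1) * k) *
        (((q ^ 2) ^ (k + 1 + l + 1) - 1) / ((q ^ 2) ^ (k + 2) - 1)) * (q ^ 2) ^ (h + 1) / q ^ 2 *
          gaussBinom (q ^ 2) (k + 1 + l) (k + 1)) := by
  have e1 : h + 1 + k + 1 - h = k + 1 + 1 := by omega
  have e2 : h + 1 + k + 1 + l - h = k + 1 + l + 1 := by omega
  rw [altSignedCoeff, if_pos (by omega), e1, e2, neg_one_pow_mul_pow_succ, gaussBinom_succ_succ,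
    Nat.add_sub_cancel, pow_succ _ h]
  field_simp

/-- The coefficient of Q^h [d-i, h] on the two sides of the three-term recurrence. The cases h = j +
1 and h = j + 2 are the boundary ones; beyond them everything is zero. -/
theorem altSignedCoeff_recurrence (hq : 1 < q) (hj : j + 1 ≤ d) (h : ℕ) :
    let b := q ^ 2
    (if h = 0 then 0 else altSignedCoeff q d (j + 1) (h - 1) * ((b ^ h - 1) * b ^ (h - 1))) +
      altSignedCoeff q d (j + 1) h * ((b ^ h - 1) * Q - (b ^ d - 1)) =
    (Q - b ^ j) * (b ^ d - b ^ j) * altSignedCoeff q d j h +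
      ((Q - 1) * (b ^ d - 1) - (Q - b ^ (j + 1)) * (b ^ d - b ^ (j + 1)) -
          (b ^ (j + 1) - 1) * b ^ j) * altSignedCoeff q d (j + 1) h +
      (b ^ (j + 2) - 1) * b ^ (j + 1) * altSignedCoeff q d (j + 2) h := by
  intro b
  have hb : 1 < b := one_lt_pow₀ hq two_ne_zero
  rcases lt_trichotomy h (j + 1) with hh | rfl | hh
  · obtain ⟨k, rfl⟩ := Nat.exists_eq_add_of_le (Nat.lt_succ_iff.1 hh)
    obtain ⟨l, rfl⟩ := Nat.exists_eq_add_of_le hj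
    have key := altSignedCoeff_generic (Q := Q) hq (h := h) (k := k) (l := l)
    cases h with
    | zero =>
      simp only [if_pos] at key ⊢
      change _ = (b ^ 0 - 1) * _ at key
      rw [pow_zero, sub_self, zero_mul] at key
      linear_combination key
    | succ h =>
      have hs := altSignedCoeff_shift hq h k l
      rw [if_neg (Nat.succ_ne_zero h), Nat.add_sub_cancel]
      linear_combination key + (b ^ (h + 1) - 1) * hs
  · rw [if_neg (Nat.succ_ne_zero j), altSignedCoeff_self,
      altSignedCoeff_of_lt q d (by omega : j < j + 1), Nat.add_sub_cancel]
    have h1 := altSignedCoeff_succ_self hq d j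
    have h2 := altSignedCoeff_succ_self hq d (j + 1)
    obtain ⟨l, rfl⟩ := Nat.exists_eq_add_of_le hj
    have e1 : j + 1 + l - j = l + 1 := by omega
    rw [e1] at h1
    rw [Nat.add_sub_cancel_left] at h2
    have hb0 : b - 1 ≠ 0 := by linarith
    have h1' : altSignedCoeff q (j + 1 + l) (j + 1) j = -(b ^ (l + 1) - 1) / (b - 1) := by
      rw [eq_div_iff hb0, mul_comm]; exact h1
    have h2' : altSignedCoeff q (j + 1 + l) (j + 2) (j + 1) = -(b ^ l - 1) / (b - 1) := by
      rw [eq_div_iff hb0, mul_comm]; exact h2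
    rw [h1', h2', pow_succ b l, pow_succ b (j + 1), pow_add b (j + 1) l, pow_succ b j]
    field_simp
    ring
  · rw [altSignedCoeff_of_lt q d hh, altSignedCoeff_of_lt q d (by omega : j < h),
      if_neg (by omega)]
    rcases eq_or_lt_of_le (Nat.succ_le_of_lt hh) with rfl | h3
    · rw [show (j + 1).succ = j + 2 from rfl, altSignedCoeff_self,
        show j + 2 - 1 = j + 1 from rfl, altSignedCoeff_self]
      ring
    · rw [altSignedCoeff_of_lt q d h3, altSignedCoeff_of_lt q d (by omega : j + 1 < h - 1)]
      ring

/-- The factor on the left is (b-1) A_1(i), by `altKrawtchouk_one`. Multiplication by it sends the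
basis function Q^h [d-i, h] to a combination of the functions with indices h and h + 1, since
b^(d-i) - 1 = (b^(d-i-h) - 1) b^h + (b^h - 1) for h ≤ d - i. -/
theorem gauss_weight_recurrence (hq : 1 < q) (hi : i ≤ d) (h : ℕ) :
    let b := q ^ 2
    (Q * (b ^ (d - i) - 1) - (b ^ d - 1)) * (Q ^ h * gaussBinom b (d - i) h) =
      (b ^ (h + 1) - 1) * b ^ h * (Q ^ (h + 1) * gaussBinom b (d - i) (h + 1)) +
        ((b ^ h - 1) * Q - (b ^ d - 1)) * (Q ^ h * gaussBinom b (d - i) h) := by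
  intro b
  have hb : 1 < b := one_lt_pow₀ hq two_ne_zero
  have h1 := gaussBinom_step hb (d - i) h
  rcases le_or_gt h (d - i) with h2 | h2
  · have h3 : b ^ (d - i) = b ^ (d - i - h) * b ^ h := by rw [← pow_add]; congr 1; omega
    rw [h3]
    linear_combination -b ^ h * Q ^ (h + 1) * h1
  · rw [gaussBinom_eq_zero _ h2, gaussBinom_eq_zero _ (by omega : d - i < h + 1)]
    ring

/-- For Q = q^m the three coefficients are b - 1 times the intersection numbers b_j, a_(j+1),
c_(j+2) of the graph, as the counts `rankTwoCount_up`, `rankTwoCount_same` and `rankTwoCount_down`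
show. -/
theorem altKrawtchouk_recurrence (hq : 1 < q) (hi : i ≤ d) (hj : j + 1 ≤ d) :
    let b := q ^ 2
    (Q * (b ^ (d - i) - 1) - (b ^ d - 1)) * altKrawtchouk q Q d (j + 1) i =
      (Q - b ^ j) * (b ^ d - b ^ j) * altKrawtchouk q Q d j i +
        ((Q - 1) * (b ^ d - 1) - (Q - b ^ (j + 1)) * (b ^ d - b ^ (j + 1)) -
          (b ^ (j + 1) - 1) * b ^ j) * altKrawtchouk q Q d (j + 1) i +
        (b ^ (j + 2) - 1) * b ^ (j + 1) * altKrawtchouk q Q d (j + 2) i := by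
  intro b
  set G : ℕ → ℝ := fun h => Q ^ h * gaussBinom b (d - i) h with hG
  set M := altSignedCoeff q d with hM
  have hsum : ∀ J N, J + 1 ≤ N → altKrawtchouk q Q d J i = ∑ h ∈ Finset.range N, M J h * G h :=
    fun J N hN => altKrawtchouk_eq_sum hN
  have h1 : (Q * (b ^ (d - i) - 1) - (b ^ d - 1)) * altKrawtchouk q Q d (j + 1) i =
      ∑ h ∈ Finset.range (j + 2), M (j + 1) h * ((b ^ (h + 1) - 1) * b ^ h) * G (h + 1) +
        ∑ h ∈ Finset.range (j + 2), M (j + 1) h * ((b ^ h - 1) * Q - (b ^ d - 1)) * G h := by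
    rw [hsum (j + 1) (j + 2) le_rfl, Finset.mul_sum, ← Finset.sum_add_distrib]
    refine Finset.sum_congr rfl fun h _ => ?_
    have := gauss_weight_recurrence (Q := Q) hq hi h
    linear_combination M (j + 1) h * this
  have h2 : ∑ h ∈ Finset.range (j + 2), M (j + 1) h * ((b ^ (h + 1) - 1) * b ^ h) * G (h + 1) =
      ∑ h ∈ Finset.range (j + 3),
        (if h = 0 then 0 else M (j + 1) (h - 1) * ((b ^ h - 1) * b ^ (h - 1))) * G h := by
    rw [Finset.sum_range_succ' _ (j + 2)]
    simp
  have h3 : ∑ h ∈ Finset.range (j + 2), M (j + 1) h * ((b ^ h - 1) * Q - (b ^ d - 1)) * G h =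
      ∑ h ∈ Finset.range (j + 3), M (j + 1) h * ((b ^ h - 1) * Q - (b ^ d - 1)) * G h := by
    rw [Finset.sum_range_succ _ (j + 2), hM, altSignedCoeff_of_lt q d (by omega : j + 1 < j + 2)]
    ring
  rw [h1, h2, h3, hsum j (j + 3) (by omega), hsum (j + 1) (j + 3) (by omega),
    hsum (j + 2) (j + 3) le_rfl, Finset.mul_sum, Finset.mul_sum, Finset.mul_sum,
    ← Finset.sum_add_distrib, ← Finset.sum_add_distrib, ← Finset.sum_add_distrib]
  refine Finset.sum_congr rfl fun h _ => ?_
  have := altSignedCoeff_recurrence (Q := Q) hq hj h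
  linear_combination G h * this

theorem altKrawtchouk_one (hq : 1 < q) (d i : ℕ) :
    (q ^ 2 - 1) * altKrawtchouk q Q d 1 i =
      Q * ((q ^ 2) ^ (d - i) - 1) - ((q ^ 2) ^ d - 1) := by
  have hb : 1 < q ^ 2 := one_lt_pow₀ hq two_ne_zero
  have h1 := altSignedCoeff_succ_self hq d 0
  have h2 := gaussBinom_step hb (d - i) 0
  rw [altKrawtchouk_eq_sum (N := 2) le_rfl]
  simp only [Finset.sum_range_succ, Finset.sum_range_zero, gaussBinom_zero_right,
    altSignedCoeff_self]
  simp only [zero_add, pow_one, pow_zero, Nat.sub_zero, gaussBinom_zero_right] at *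
  linear_combination h1 + Q * h2

end Recurrence

/-! ### Rank-two perturbations of alternating matrices -/

section Wedge

variable {F : Type*} [Field F] {n : ℕ}

theorem dotProduct_mulVec_skew {Z : Matrix (Fin n) (Fin n) F} (hZ : Z ∈ altMatrices F n)
    (x y : Fin n → F) : x ⬝ᵥ Z *ᵥ y = -(y ⬝ᵥ Z *ᵥ x) := by
  have h : Zᵀ = -Z := hZ.1
  rw [Matrix.dotProduct_mulVec, ← Matrix.mulVec_transpose, h, Matrix.neg_mulVec, neg_dotProduct,
    dotProduct_comm]

theorem dotProduct_mulVec_self {Z : Matrix (Fin n) (Fin n) F} (hZ : Z ∈ altMatrices F n)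
    (x : Fin n → F) : x ⬝ᵥ Z *ᵥ x = 0 := by
  have h1 : Zᵀ = -Z := hZ.1
  have h2 := hZ.2
  have h3 : ∀ i j, Z j i = -Z i j := fun i j => congrFun (congrFun h1 i) j
  simp only [dotProduct, Matrix.mulVec, Finset.mul_sum]
  rw [← Finset.sum_product']
  refine Finset.sum_involution (fun p _ => (p.2, p.1)) ?_ ?_ ?_ ?_
  · rintro ⟨i, j⟩ _
    simp only [h3 i j]
    ring
  · rintro ⟨i, j⟩ _ h hij
    simp only [Prod.mk.injEq] at hij
    rw [hij.1] at h
    simp [h2] at h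
  · simp
  · simp

/-- The alternating matrix `u vᵀ - v uᵀ`. -/
def wedgeMatrix (u v : Fin n → F) : Matrix (Fin n) (Fin n) F :=
  Matrix.vecMulVec u v - Matrix.vecMulVec v u

theorem wedgeMatrix_mem (u v : Fin n → F) : wedgeMatrix u v ∈ altMatrices F n := by
  constructor
  · ext i j
    simp [wedgeMatrix, Matrix.vecMulVec_apply]
    ring
  · intro i
    simp [wedgeMatrix, Matrix.vecMulVec_apply]
    ring

theorem wedgeMatrix_swap (u v : Fin n → F) : wedgeMatrix v u = -wedgeMatrix u v := by
  simp [wedgeMatrix]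

theorem wedgeMatrix_mulVec (u v x : Fin n → F) :
    wedgeMatrix u v *ᵥ x = (v ⬝ᵥ x) • u - (u ⬝ᵥ x) • v := by
  simp [wedgeMatrix, Matrix.sub_mulVec, Matrix.vecMulVec_mulVec]

/-- The column space of a matrix. -/
abbrev colSpace (Z : Matrix (Fin n) (Fin n) F) : Submodule F (Fin n → F) :=
  LinearMap.range Z.mulVecLin

theorem mulVec_mem_colSpace (Z : Matrix (Fin n) (Fin n) F) (x : Fin n → F) :
    Z *ᵥ x ∈ colSpace Z := ⟨x, rfl⟩

/-- The column space of an alternating matrix is the orthogonal of its kernel. -/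
theorem exists_mulVec_eq_zero_dotProduct_ne_zero {Z : Matrix (Fin n) (Fin n) F}
    (hZ : Z ∈ altMatrices F n) {U : Submodule F (Fin n → F)} (hU : colSpace Z ≤ U)
    {u : Fin n → F} (hu : u ∉ U) :
    ∃ x, Z *ᵥ x = 0 ∧ u ⬝ᵥ x ≠ 0 ∧ ∀ w ∈ U, w ⬝ᵥ x = 0 := by
  obtain ⟨f, hf, hfU⟩ := Submodule.exists_le_ker_of_notMem hu
  have hfx : ∀ w, f w = w ⬝ᵥ fun i => f (Pi.single i 1) := by
    intro w
    conv_lhs => rw [← Finset.univ_sum_single w, map_sum]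
    simp only [dotProduct]
    refine Finset.sum_congr rfl fun i _ => ?_
    rw [← smul_eq_mul, ← map_smul, ← Pi.single_smul, smul_eq_mul, mul_one]
  refine ⟨fun i => f (Pi.single i 1), ?_, ?_, ?_⟩
  · rw [← dotProduct_eq_zero_iff]
    intro y
    rw [dotProduct_comm, dotProduct_mulVec_skew hZ, dotProduct_comm, ← hfx, neg_eq_zero]
    exact hfU (hU (mulVec_mem_colSpace Z y))
  · rwa [← hfx]
  · intro w hw
    rw [← hfx]
    exact hfU hw

theorem colSpace_sub_wedgeMatrix_le (Z : Matrix (Fin n) (Fin n) F) (u v : Fin n → F) :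
    colSpace (Z - wedgeMatrix u v) ≤ colSpace Z ⊔ F ∙ u ⊔ F ∙ v := by
  rintro _ ⟨x, rfl⟩
  rw [Matrix.mulVecLin_apply, Matrix.sub_mulVec, wedgeMatrix_mulVec]
  have hu : u ∈ colSpace Z ⊔ F ∙ u ⊔ F ∙ v :=
    Submodule.mem_sup_left (Submodule.mem_sup_right (Submodule.mem_span_singleton_self u))
  have hv : v ∈ colSpace Z ⊔ F ∙ u ⊔ F ∙ v :=
    Submodule.mem_sup_right (Submodule.mem_span_singleton_self v)
  exact sub_mem (Submodule.mem_sup_left (Submodule.mem_sup_left (mulVec_mem_colSpace Z x)))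
    (sub_mem (Submodule.smul_mem _ _ hu) (Submodule.smul_mem _ _ hv))

theorem finrank_sup_span_singleton_le (U : Submodule F (Fin n → F)) (u : Fin n → F) :
    Module.finrank F (U ⊔ F ∙ u : Submodule F (Fin n → F)) ≤ Module.finrank F U + 1 :=
  (Submodule.finrank_add_le_finrank_add_finrank _ _).trans
    (Nat.add_le_add_left (by simpa using finrank_span_le_card (R := F) ({u} : Set (Fin n → F))) _)

theorem sup_span_singleton_of_mem {U : Submodule F (Fin n → F)} {u : Fin n → F}
    (hu : u ∈ U) : U ⊔ F ∙ u = U :=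
  sup_eq_left.2 ((Submodule.span_singleton_le_iff_mem _ _).2 hu)

theorem rank_sub_wedgeMatrix_le (Z : Matrix (Fin n) (Fin n) F) (u v : Fin n → F) :
    (Z - wedgeMatrix u v).rank ≤ Z.rank + 2 := by
  have h1 := Submodule.finrank_mono (colSpace_sub_wedgeMatrix_le Z u v)
  have h2 := finrank_sup_span_singleton_le (colSpace Z ⊔ F ∙ u) v
  have h3 := finrank_sup_span_singleton_le (colSpace Z) u
  change Module.finrank F (colSpace (Z - wedgeMatrix u v)) ≤ Module.finrank F (colSpace Z) + 2
  omega

/-- On x in the kernel of Z the difference takes the value (u·x) v - (v·x) u. Choosing x orthogonal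
to u but not to v puts u into the column space; choosing x not orthogonal to u then yields v. -/
theorem colSpace_sub_wedgeMatrix_of_notMem {Z : Matrix (Fin n) (Fin n) F}
    (hZ : Z ∈ altMatrices F n) {u v : Fin n → F} (hu : u ∉ colSpace Z)
    (hv : v ∉ colSpace Z ⊔ F ∙ u) :
    colSpace (Z - wedgeMatrix u v) = colSpace Z ⊔ F ∙ u ⊔ F ∙ v := by
  refine le_antisymm (colSpace_sub_wedgeMatrix_le Z u v) ?_
  have hu' : u ∈ colSpace (Z - wedgeMatrix u v) := by
    obtain ⟨x, hx, hvx, hU⟩ := exists_mulVec_eq_zero_dotProduct_ne_zero hZ le_sup_left hv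
    have hux := hU u (Submodule.mem_sup_right (Submodule.mem_span_singleton_self u))
    have := mulVec_mem_colSpace (Z - wedgeMatrix u v) x
    rw [Matrix.sub_mulVec, wedgeMatrix_mulVec, hx, hux, zero_smul, sub_zero, zero_sub,
      neg_mem_iff] at this
    exact (Submodule.smul_mem_iff _ hvx).1 this
  have hv' : v ∈ colSpace (Z - wedgeMatrix u v) := by
    obtain ⟨x, hx, hux, -⟩ := exists_mulVec_eq_zero_dotProduct_ne_zero hZ le_rfl hu
    have := mulVec_mem_colSpace (Z - wedgeMatrix u v) x
    rw [Matrix.sub_mulVec, wedgeMatrix_mulVec, hx, zero_sub, neg_sub] at this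
    exact (Submodule.smul_mem_iff _ hux).1
      ((Submodule.sub_mem_iff_left _ (Submodule.smul_mem _ _ hu')).1 this)
  refine sup_le (sup_le ?_ ?_) ?_
  · rintro _ ⟨x, rfl⟩
    have h1 := mulVec_mem_colSpace (Z - wedgeMatrix u v) x
    rw [Matrix.sub_mulVec, wedgeMatrix_mulVec] at h1
    exact (Submodule.sub_mem_iff_left _
      (sub_mem (Submodule.smul_mem _ _ hu') (Submodule.smul_mem _ _ hv'))).1 h1
  · exact (Submodule.span_singleton_le_iff_mem _ _).2 hu'
  · exact (Submodule.span_singleton_le_iff_mem _ _).2 hv'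

theorem rank_sub_wedgeMatrix_eq_add_two_iff {Z : Matrix (Fin n) (Fin n) F}
    (hZ : Z ∈ altMatrices F n) {u v : Fin n → F} :
    (Z - wedgeMatrix u v).rank = Z.rank + 2 ↔ u ∉ colSpace Z ∧ v ∉ colSpace Z ⊔ F ∙ u := by
  change Module.finrank F (colSpace (Z - wedgeMatrix u v)) = Module.finrank F (colSpace Z) + 2 ↔ _
  have h1 := Submodule.finrank_mono (colSpace_sub_wedgeMatrix_le Z u v)
  have h2 := finrank_sup_span_singleton_le (colSpace Z ⊔ F ∙ u) v
  have h3 := finrank_sup_span_singleton_le (colSpace Z) u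
  constructor
  · intro h
    constructor
    · intro hu
      rw [sup_span_singleton_of_mem hu] at h1 h2
      omega
    · intro hv
      rw [sup_span_singleton_of_mem hv] at h1
      omega
  · rintro ⟨hu, hv⟩
    rw [colSpace_sub_wedgeMatrix_of_notMem hZ hu hv, Submodule.finrank_sup_span_singleton hv,
      Submodule.finrank_sup_span_singleton hu]

/-- Read backwards this is a rank increase: Z arises from Z - u ∧ v by subtracting v ∧ u, so the
criterion for an increase by two applies. -/
theorem rank_sub_wedgeMatrix_add_two_eq_iff {Z : Matrix (Fin n) (Fin n) F}
    (hZ : Z ∈ altMatrices F n) {u v : Fin n → F} :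
    (Z - wedgeMatrix u v).rank + 2 = Z.rank ↔
      ∃ a c, Z *ᵥ a = u ∧ Z *ᵥ c = v ∧ a ⬝ᵥ Z *ᵥ c = 1 := by
  have hZ' : Z - wedgeMatrix u v ∈ altMatrices F n := sub_mem hZ (wedgeMatrix_mem u v)
  have hZZ : Z - wedgeMatrix u v - wedgeMatrix v u = Z := by rw [wedgeMatrix_swap]; abel
  constructor
  · intro h
    have h1 := (rank_sub_wedgeMatrix_eq_add_two_iff (u := v) (v := u) hZ').1 (by rw [hZZ, h])
    have h2 := colSpace_sub_wedgeMatrix_of_notMem hZ' h1.1 h1.2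
    rw [hZZ] at h2
    have hu : u ∈ colSpace Z := by
      rw [h2]
      exact Submodule.mem_sup_right (Submodule.mem_span_singleton_self u)
    have hv : v ∈ colSpace Z := by
      rw [h2]
      exact Submodule.mem_sup_left
        (Submodule.mem_sup_right (Submodule.mem_span_singleton_self v))
    obtain ⟨a, rfl⟩ := hu
    obtain ⟨c, rfl⟩ := hv
    refine ⟨a, c, rfl, rfl, ?_⟩
    -- The reduced matrix sends a to (1 - aᵀZc) u; if the factor were nonzero, u would lie in its
    -- column space.
    by_contra hne
    have h3 := mulVec_mem_colSpace (Z - wedgeMatrix (Z.mulVecLin a) (Z.mulVecLin c)) a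
    rw [Matrix.sub_mulVec, wedgeMatrix_mulVec] at h3
    simp only [Matrix.mulVecLin_apply] at h1 h3
    rw [dotProduct_comm (Z *ᵥ a), dotProduct_mulVec_self hZ, zero_smul, sub_zero,
      dotProduct_comm, ← one_smul F (Z *ᵥ a), smul_smul, mul_one, ← sub_smul] at h3
    refine h1.2 (Submodule.mem_sup_left ?_)
    have := (Submodule.smul_mem_iff _ (sub_ne_zero.2 (Ne.symm hne))).1 h3
    simpa using this
  · rintro ⟨a, c, rfl, rfl, h⟩
    set u := Z *ᵥ a with hu
    set v := Z *ᵥ c with hv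
    have hca : c ⬝ᵥ u = -1 := by rw [hu, dotProduct_mulVec_skew hZ, h]
    have haa : a ⬝ᵥ u = 0 := dotProduct_mulVec_self hZ a
    have hcc : c ⬝ᵥ v = 0 := dotProduct_mulVec_self hZ c
    have h1 : (Z - wedgeMatrix u v) *ᵥ a = 0 := by
      rw [Matrix.sub_mulVec, wedgeMatrix_mulVec, dotProduct_comm v, h, dotProduct_comm u, haa,
        ← hu]
      simp
    have h2 : (Z - wedgeMatrix u v) *ᵥ c = 0 := by
      rw [Matrix.sub_mulVec, wedgeMatrix_mulVec, dotProduct_comm v, hcc, dotProduct_comm u, hca,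
        ← hv]
      simp
    have h3 : ∀ w ∈ colSpace (Z - wedgeMatrix u v), a ⬝ᵥ w = 0 ∧ c ⬝ᵥ w = 0 := by
      rintro _ ⟨x, rfl⟩
      simp only [Matrix.mulVecLin_apply]
      rw [dotProduct_mulVec_skew hZ' a, dotProduct_mulVec_skew hZ' c, h1, h2]
      simp
    have hvn : v ∉ colSpace (Z - wedgeMatrix u v) := fun hm =>
      one_ne_zero (h.symm.trans (h3 _ hm).1)
    have hun : u ∉ colSpace (Z - wedgeMatrix u v) ⊔ F ∙ v := by
      intro hm
      obtain ⟨w, hw, z, hz, hwz⟩ := Submodule.mem_sup.1 hm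
      obtain ⟨t, rfl⟩ := Submodule.mem_span_singleton.1 hz
      rw [← hwz, dotProduct_add, (h3 w hw).2, dotProduct_smul, hcc] at hca
      simp at hca
    have := (rank_sub_wedgeMatrix_eq_add_two_iff (u := v) (v := u) hZ').2 ⟨hvn, hun⟩
    rw [hZZ] at this
    exact this.symm

/-- A nonzero alternating matrix can be reduced by an alternating matrix of rank two. -/
theorem exists_rank_sub_wedgeMatrix_add_two_eq {Z : Matrix (Fin n) (Fin n) F}
    (hZ : Z ∈ altMatrices F n) (hZ0 : Z ≠ 0) :
    ∃ u v, (Z - wedgeMatrix u v).rank + 2 = Z.rank := by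
  obtain ⟨i, j, hij⟩ : ∃ i j, Z i j ≠ 0 := by
    by_contra! h
    exact hZ0 (Matrix.ext h)
  -- Basis vectors at a nonzero entry, the second one scaled so that aᵀZc = 1.
  refine ⟨_, _, (rank_sub_wedgeMatrix_add_two_eq_iff hZ).2
    ⟨Pi.single i 1, Pi.single j (Z i j)⁻¹, rfl, rfl, ?_⟩⟩
  simp [hij]

theorem rank_add_finrank_ker (Z : Matrix (Fin n) (Fin n) F) :
    Z.rank + Module.finrank F (LinearMap.ker Z.mulVecLin) = n := by
  have := LinearMap.finrank_range_add_finrank_ker Z.mulVecLin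
  rwa [Module.finrank_fin_fun] at this

theorem matrix_eq_zero_of_rank_eq_zero {Z : Matrix (Fin n) (Fin n) F} (h : Z.rank = 0) :
    Z = 0 := by
  have h1 : LinearMap.range Z.mulVecLin = ⊥ := Submodule.finrank_eq_zero.1 h
  have h2 : Z.mulVecLin = 0 := LinearMap.range_eq_bot.1 h1
  ext i j
  have := congrFun (LinearMap.congr_fun h2 (Pi.single j 1)) i
  simpa using this

theorem even_rank_of_mem_altMatrices {Z : Matrix (Fin n) (Fin n) F}
    (hZ : Z ∈ altMatrices F n) : Even Z.rank := by
  induction hr : Z.rank using Nat.strong_induction_on generalizing Z with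
  | _ r ih =>
    by_cases h0 : Z = 0
    · subst h0
      rw [← hr, Matrix.rank_zero]
      exact Even.zero
    · obtain ⟨u, v, huv⟩ := exists_rank_sub_wedgeMatrix_add_two_eq hZ h0
      have := ih _ (by omega) (sub_mem hZ (wedgeMatrix_mem u v)) rfl
      rw [← hr, ← huv]
      exact this.add even_two

theorem rank_add_le_rank_add_rank (A B : Matrix (Fin n) (Fin n) F) :
    (A + B).rank ≤ A.rank + B.rank := by
  refine le_trans (Submodule.finrank_mono ?_)
    (Submodule.finrank_add_le_finrank_add_finrank (colSpace A) (colSpace B))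
  rintro _ ⟨x, rfl⟩
  rw [Matrix.mulVecLin_apply, Matrix.add_mulVec]
  exact Submodule.add_mem_sup (mulVec_mem_colSpace A x) (mulVec_mem_colSpace B x)

theorem rank_neg_matrix (A : Matrix (Fin n) (Fin n) F) : (-A).rank = A.rank := by
  have : (-A).mulVecLin = -A.mulVecLin := by
    ext
    simp
  rw [Matrix.rank, this, LinearMap.range_neg]
  rfl

theorem rank_wedgeMatrix_le (u v : Fin n → F) : (wedgeMatrix u v).rank ≤ 2 := by
  have := rank_sub_wedgeMatrix_le 0 v u
  rwa [wedgeMatrix_swap, sub_neg_eq_add, zero_add, Matrix.rank_zero, zero_add] at this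

theorem rank_wedgeMatrix_of_rank_eq {Z : Matrix (Fin n) (Fin n) F} {u v : Fin n → F}
    (h : (Z - wedgeMatrix u v).rank = Z.rank + 2 ∨ (Z - wedgeMatrix u v).rank + 2 = Z.rank) :
    (wedgeMatrix u v).rank = 2 := by
  refine le_antisymm (rank_wedgeMatrix_le u v) ?_
  rcases h with h | h
  · have h1 := rank_add_le_rank_add_rank Z (wedgeMatrix v u)
    rw [wedgeMatrix_swap u v, ← sub_eq_add_neg, rank_neg_matrix] at h1
    omega
  · have h1 := rank_add_le_rank_add_rank (Z - wedgeMatrix u v) (wedgeMatrix u v)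
    rw [sub_add_cancel] at h1
    omega

/-- Subadditivity bounds the change of rank by two, and parity excludes a change by one. -/
theorem rank_sub_trichotomy (Z X : altMatrices F n)
    (hX : (X : Matrix (Fin n) (Fin n) F).rank = 2) :
    ((Z - X : altMatrices F n) : Matrix (Fin n) (Fin n) F).rank =
        (Z : Matrix (Fin n) (Fin n) F).rank + 2 ∨
      ((Z - X : altMatrices F n) : Matrix (Fin n) (Fin n) F).rank =
        (Z : Matrix (Fin n) (Fin n) F).rank ∨
      ((Z - X : altMatrices F n) : Matrix (Fin n) (Fin n) F).rank + 2 =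
        (Z : Matrix (Fin n) (Fin n) F).rank := by
  have h1 := rank_add_le_rank_add_rank (Z : Matrix (Fin n) (Fin n) F) (-X)
  have h2 := rank_add_le_rank_add_rank ((Z - X : altMatrices F n) : Matrix (Fin n) (Fin n) F) X
  rw [rank_neg_matrix, ← sub_eq_add_neg] at h1
  rw [← Submodule.coe_add, sub_add_cancel] at h2
  rw [← Submodule.coe_sub] at h1
  obtain ⟨a, ha⟩ := even_rank_of_mem_altMatrices Z.2
  obtain ⟨c, hc⟩ := even_rank_of_mem_altMatrices (Z - X).2
  omega

end Wedge

/-! ### Counting -/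

section Count

variable {F : Type*} [Field F] [Fintype F] {n : ℕ}

open Classical in
theorem card_filter_eq_pow_finrank_ker {U : Type*} [AddCommGroup U] [Module F U]
    (f : (Fin n → F) →ₗ[F] U) (x₀ : Fin n → F) :
    (Finset.univ.filter fun x => f x = f x₀).card =
      Fintype.card F ^ Module.finrank F (LinearMap.ker f) := by
  rw [← Module.card_eq_pow_finrank, Fintype.card_of_subtype
    (Finset.univ.filter fun x => f x = 0) (by simp)]
  refine Finset.card_bij (fun x _ => x - x₀) ?_ ?_ ?_
  · intro x hx
    simpa [sub_eq_zero] using hx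
  · intro x _ y _ h
    exact sub_left_injective h
  · intro y hy
    refine ⟨y + x₀, ?_, add_sub_cancel_right _ _⟩
    simpa using hy

open Classical in
theorem card_filter_dotProduct_eq_one {w : Fin n → F} (hw : w ≠ 0) :
    (Finset.univ.filter fun c => w ⬝ᵥ c = 1).card * Fintype.card F = Fintype.card F ^ n := by
  have hf : dotProductEquiv F (Fin n) w ≠ 0 := by simpa using hw
  have hfin := Module.Dual.finrank_ker_add_one_of_ne_zero hf
  rw [Module.finrank_fin_fun] at hfin
  obtain ⟨i, hi⟩ := Function.ne_iff.1 hw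
  have h1 : dotProductEquiv F (Fin n) w (Pi.single i (w i)⁻¹) = 1 := by
    simpa using mul_inv_cancel₀ hi
  have h2 := card_filter_eq_pow_finrank_ker (dotProductEquiv F (Fin n) w)
    (Pi.single i (w i)⁻¹)
  rw [h1] at h2
  simp only [dotProductEquiv_apply_apply] at h2
  rw [h2, ← pow_succ, hfin]

open Classical in
theorem card_filter_dotProduct_mulVec_eq_one {Z : Matrix (Fin n) (Fin n) F}
    (hZ : Z ∈ altMatrices F n) :
    (((Finset.univ.filter fun p : (Fin n → F) × (Fin n → F) =>
        p.1 ⬝ᵥ Z *ᵥ p.2 = 1).card : ℕ) : ℝ) * Fintype.card F =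
      ((Fintype.card F : ℝ) ^ n -
        (Fintype.card F : ℝ) ^ Module.finrank F (LinearMap.ker Z.mulVecLin)) *
        (Fintype.card F : ℝ) ^ n := by
  have h1 : (Finset.univ.filter fun p : (Fin n → F) × (Fin n → F) =>
      p.1 ⬝ᵥ Z *ᵥ p.2 = 1).card * Fintype.card F =
      (Finset.univ.filter fun a : Fin n → F => ¬ Z *ᵥ a = 0).card * Fintype.card F ^ n := by
    rw [Finset.card_filter, Fintype.sum_prod_type, Finset.sum_mul, Finset.card_filter,
      Finset.sum_mul]
    refine Finset.sum_congr rfl fun a _ => ?_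
    rw [← Finset.card_filter]
    have h2 : ∀ c, a ⬝ᵥ Z *ᵥ c = (-(Z *ᵥ a)) ⬝ᵥ c := fun c => by
      rw [dotProduct_mulVec_skew hZ, dotProduct_comm, neg_dotProduct]
    simp only [h2]
    by_cases ha : Z *ᵥ a = 0
    · simp [ha]
    · rw [card_filter_dotProduct_eq_one (neg_ne_zero.2 ha), if_pos ha, one_mul]
  have h3 := Finset.card_filter_add_card_filter_not (s := Finset.univ)
    (fun a : Fin n → F => Z *ᵥ a = 0)
  have h4 := card_filter_eq_pow_finrank_ker Z.mulVecLin 0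
  simp only [Matrix.mulVecLin_apply, map_zero] at h4
  rw [h4, Finset.card_univ, Fintype.card_fun, Fintype.card_fin] at h3
  have h5 : (((Finset.univ.filter fun a : Fin n → F => ¬ Z *ᵥ a = 0).card : ℕ) : ℝ) =
      (Fintype.card F : ℝ) ^ n -
        (Fintype.card F : ℝ) ^ Module.finrank F (LinearMap.ker Z.mulVecLin) := by
    rw [eq_sub_iff_add_eq']
    exact_mod_cast h3
  rw [← h5]
  exact_mod_cast h1

open Classical in
-- The map (a, c) ↦ (Za, Zc) sends the pairs with aᵀZc = 1 onto the pairs counted here, and its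
-- fibres are cosets of ker Z × ker Z.
theorem card_pairs_rank_add_two {Z : Matrix (Fin n) (Fin n) F} (hZ : Z ∈ altMatrices F n) :
    (((Finset.univ.filter fun p : (Fin n → F) × (Fin n → F) =>
        (Z - wedgeMatrix p.1 p.2).rank + 2 = Z.rank).card : ℕ) : ℝ) * Fintype.card F =
      ((Fintype.card F : ℝ) ^ Z.rank - 1) * (Fintype.card F : ℝ) ^ Z.rank := by
  set κ := Module.finrank F (LinearMap.ker Z.mulVecLin) with hκ
  have hn : Z.rank + κ = n := rank_add_finrank_ker Z
  have h1 := card_filter_dotProduct_mulVec_eq_one hZ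
  have h2 : (Finset.univ.filter fun p : (Fin n → F) × (Fin n → F) =>
      p.1 ⬝ᵥ Z *ᵥ p.2 = 1).card =
      (Finset.univ.filter fun p : (Fin n → F) × (Fin n → F) =>
        (Z - wedgeMatrix p.1 p.2).rank + 2 = Z.rank).card * (Fintype.card F ^ κ) ^ 2 := by
    rw [Finset.card_eq_sum_card_fiberwise (f := fun p => (Z *ᵥ p.1, Z *ᵥ p.2))
      (t := Finset.univ.filter fun p : (Fin n → F) × (Fin n → F) =>
        (Z - wedgeMatrix p.1 p.2).rank + 2 = Z.rank)]
    · rw [Finset.sum_const_nat]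
      rintro ⟨u, v⟩ huv
      simp only [Finset.mem_filter, Finset.mem_univ, true_and,
        rank_sub_wedgeMatrix_add_two_eq_iff hZ] at huv
      obtain ⟨a, c, rfl, rfl, hac⟩ := huv
      rw [pow_two]
      nth_rewrite 1 [hκ, ← card_filter_eq_pow_finrank_ker Z.mulVecLin a]
      rw [hκ, ← card_filter_eq_pow_finrank_ker Z.mulVecLin c, ← Finset.card_product]
      congr 1
      ext ⟨x, y⟩
      simp only [Finset.mem_filter, Finset.mem_univ, true_and, Prod.mk.injEq, Finset.mem_product]
      simp only [Matrix.mulVecLin_apply, and_iff_right_iff_imp]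
      rintro ⟨hx, hy⟩
      rw [hy, dotProduct_mulVec_skew hZ, hx, ← dotProduct_mulVec_skew hZ, hac]
    · rintro ⟨a, c⟩ h
      simp only [Finset.coe_filter, Finset.mem_univ, true_and, Set.mem_ofPred_eq] at h ⊢
      exact (rank_sub_wedgeMatrix_add_two_eq_iff hZ).2 ⟨a, c, rfl, rfl, h⟩
  rw [h2] at h1
  have hq : (0 : ℝ) < Fintype.card F := by exact_mod_cast Fintype.card_pos
  have hqκ : ((Fintype.card F : ℝ) ^ κ) ^ 2 ≠ 0 := by positivity
  apply mul_right_cancel₀ hqκ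
  push_cast at h1
  have h3 : (Fintype.card F : ℝ) ^ n =
      (Fintype.card F : ℝ) ^ Z.rank * (Fintype.card F : ℝ) ^ κ := by
    rw [← pow_add, hn]
  rw [h3] at h1
  linear_combination h1

open Classical in
theorem card_filter_notMem (U : Submodule F (Fin n → F)) :
    (((Finset.univ.filter fun u => u ∉ U).card : ℕ) : ℝ) =
      (Fintype.card F : ℝ) ^ n - (Fintype.card F : ℝ) ^ Module.finrank F U := by
  have h3 := Finset.card_filter_add_card_filter_not (s := Finset.univ)
    (fun u : Fin n → F => u ∈ U)
  have h4 : (Finset.univ.filter fun u => u ∈ U).card =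
      Fintype.card F ^ Module.finrank F U := by
    rw [← Module.card_eq_pow_finrank, Fintype.card_of_subtype
      (Finset.univ.filter fun u => u ∈ U) (by simp)]
  rw [h4, Finset.card_univ, Fintype.card_fun, Fintype.card_fin] at h3
  rw [eq_sub_iff_add_eq']
  exact_mod_cast h3

open Classical in
theorem card_pairs_rank_eq_add_two {Z : Matrix (Fin n) (Fin n) F} (hZ : Z ∈ altMatrices F n) :
    (((Finset.univ.filter fun p : (Fin n → F) × (Fin n → F) =>
        (Z - wedgeMatrix p.1 p.2).rank = Z.rank + 2).card : ℕ) : ℝ) =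
      ((Fintype.card F : ℝ) ^ n - (Fintype.card F : ℝ) ^ Z.rank) *
        ((Fintype.card F : ℝ) ^ n - (Fintype.card F : ℝ) ^ (Z.rank + 1)) := by
  simp only [rank_sub_wedgeMatrix_eq_add_two_iff hZ]
  have h0 := card_filter_notMem (colSpace Z)
  change _ = _ - (Fintype.card F : ℝ) ^ Z.rank at h0
  rw [← h0, Finset.card_filter, Fintype.sum_prod_type, Finset.card_filter, Nat.cast_sum,
    Nat.cast_sum, Finset.sum_mul]
  refine Finset.sum_congr rfl fun u _ => ?_
  by_cases hu : u ∈ colSpace Z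
  · simp [hu]
  · have h1 := card_filter_notMem (colSpace Z ⊔ F ∙ u)
    rw [Submodule.finrank_sup_span_singleton hu] at h1
    change _ = _ - (Fintype.card F : ℝ) ^ (Z.rank + 1) at h1
    simp only [hu, not_false_eq_true, true_and, if_true, Nat.cast_one, one_mul]
    rw [← h1, ← Finset.card_filter]

/-- The number of alternating `X` of rank two with `Z - X` of rank `t`. -/
noncomputable def rankTwoCount (Z : altMatrices F n) (t : ℕ) : ℕ :=
  Nat.card {X : altMatrices F n //
    (X : Matrix (Fin n) (Fin n) F).rank = 2 ∧
      ((Z - X : altMatrices F n) : Matrix (Fin n) (Fin n) F).rank = t}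

open Classical in
-- The preceding count for Z = X: the rank drops from 2 to 0 exactly when u ∧ v = X. This
-- multiplicity converts counts of pairs into counts of matrices.
theorem card_filter_wedgeMatrix_eq {X : Matrix (Fin n) (Fin n) F} (hX : X ∈ altMatrices F n)
    (hr : X.rank = 2) :
    (((Finset.univ.filter fun p : (Fin n → F) × (Fin n → F) =>
      wedgeMatrix p.1 p.2 = X).card : ℕ) : ℝ) =
      ((Fintype.card F : ℝ) ^ 2 - 1) * Fintype.card F := by
  have h := card_pairs_rank_add_two hX
  have hq : (Fintype.card F : ℝ) ≠ 0 := by exact_mod_cast Fintype.card_ne_zero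
  apply mul_right_cancel₀ hq
  rw [hr] at h
  have h2 : ∀ p : (Fin n → F) × (Fin n → F),
      (X - wedgeMatrix p.1 p.2).rank + 2 = 2 ↔ wedgeMatrix p.1 p.2 = X := fun p => by
    rw [Nat.add_eq_right]
    exact ⟨fun h => (sub_eq_zero.1 (matrix_eq_zero_of_rank_eq_zero h)).symm, fun h => by simp [h]⟩
  simp only [h2] at h
  rw [h]
  ring

open Classical in
theorem rankTwoCount_mul (Z : altMatrices F n) (t : ℕ) :
    (rankTwoCount Z t : ℝ) * (((Fintype.card F : ℝ) ^ 2 - 1) * Fintype.card F) =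
      ((Finset.univ.filter fun p : (Fin n → F) × (Fin n → F) =>
        (wedgeMatrix p.1 p.2).rank = 2 ∧
          ((Z : Matrix (Fin n) (Fin n) F) - wedgeMatrix p.1 p.2).rank = t).card : ℕ) := by
  rw [rankTwoCount, Nat.card_eq_fintype_card, Fintype.card_subtype]
  rw [Finset.card_eq_sum_card_fiberwise
    (s := Finset.univ.filter fun p : (Fin n → F) × (Fin n → F) =>
        (wedgeMatrix p.1 p.2).rank = 2 ∧
          ((Z : Matrix (Fin n) (Fin n) F) - wedgeMatrix p.1 p.2).rank = t)
    (f := fun p => (⟨wedgeMatrix p.1 p.2, wedgeMatrix_mem p.1 p.2⟩ : altMatrices F n))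
    (t := Finset.univ.filter fun X : altMatrices F n =>
      (X : Matrix (Fin n) (Fin n) F).rank = 2 ∧
        ((Z - X : altMatrices F n) : Matrix (Fin n) (Fin n) F).rank = t)]
  · rw [Nat.cast_sum, Finset.sum_congr rfl (g := fun _ =>
      ((Fintype.card F : ℝ) ^ 2 - 1) * Fintype.card F), Finset.sum_const, nsmul_eq_mul]
    rintro ⟨X, hX⟩ h
    simp only [Finset.mem_filter, Finset.mem_univ, true_and] at h
    rw [← card_filter_wedgeMatrix_eq hX h.1, Finset.filter_filter]
    congr 2
    ext p
    simp only [Finset.mem_filter, Finset.mem_univ, true_and, Subtype.mk.injEq,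
      and_iff_right_iff_imp]
    rintro rfl
    exact h
  · intro p hp
    simpa using hp

theorem rankTwoCount_add_two (Z : altMatrices F n) :
    (rankTwoCount Z ((Z : Matrix (Fin n) (Fin n) F).rank + 2) : ℝ) *
        (((Fintype.card F : ℝ) ^ 2 - 1) * Fintype.card F) =
      ((Fintype.card F : ℝ) ^ n - (Fintype.card F : ℝ) ^ (Z : Matrix (Fin n) (Fin n) F).rank) *
        ((Fintype.card F : ℝ) ^ n -
          (Fintype.card F : ℝ) ^ ((Z : Matrix (Fin n) (Fin n) F).rank + 1)) := by
  classical
  rw [rankTwoCount_mul, ← card_pairs_rank_eq_add_two Z.2]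
  congr 2
  ext p
  simp only [Finset.mem_filter, Finset.mem_univ, true_and, and_iff_right_iff_imp]
  exact fun h => rank_wedgeMatrix_of_rank_eq (Or.inl h)

theorem rankTwoCount_sub_two (Z : altMatrices F n) {t : ℕ}
    (ht : t + 2 = (Z : Matrix (Fin n) (Fin n) F).rank) :
    (rankTwoCount Z t : ℝ) * (((Fintype.card F : ℝ) ^ 2 - 1) * Fintype.card F) *
        Fintype.card F =
      ((Fintype.card F : ℝ) ^ (t + 2) - 1) * (Fintype.card F : ℝ) ^ (t + 2) := by
  classical
  rw [rankTwoCount_mul, ht, ← card_pairs_rank_add_two Z.2]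
  congr 3
  ext p
  simp only [Finset.mem_filter, Finset.mem_univ, true_and]
  constructor
  · rintro ⟨-, h⟩
    omega
  · intro h
    exact ⟨rank_wedgeMatrix_of_rank_eq (Or.inr h), by omega⟩

end Count

/-! ### Distances in the alternating forms graph -/

section Distance

variable {F : Type*} [Field F] {n : ℕ}

theorem exists_walk_of_rank_sub_eq (k : ℕ) (X Y : altMatrices F n)
    (h : ((X - Y : altMatrices F n) : Matrix (Fin n) (Fin n) F).rank = 2 * k) :
    ∃ p : (altGraph F n).Walk X Y, p.length = k := by
  induction k generalizing X with
  | zero =>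
    have : X = Y := sub_eq_zero.1 (Subtype.ext (matrix_eq_zero_of_rank_eq_zero h))
    subst this
    exact ⟨.nil, rfl⟩
  | succ k ih =>
    have h0 : ((X - Y : altMatrices F n) : Matrix (Fin n) (Fin n) F) ≠ 0 := by
      intro h0
      rw [h0, Matrix.rank_zero] at h
      omega
    obtain ⟨u, v, huv⟩ := exists_rank_sub_wedgeMatrix_add_two_eq (X - Y).2 h0
    obtain ⟨p, hp⟩ := ih (X - ⟨wedgeMatrix u v, wedgeMatrix_mem u v⟩) (by
      rw [sub_right_comm, Submodule.coe_sub]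
      change (_ - wedgeMatrix u v).rank = _
      omega)
    have hadj : (altGraph F n).Adj X (X - ⟨wedgeMatrix u v, wedgeMatrix_mem u v⟩) := by
      change ((X : Matrix (Fin n) (Fin n) F) - (X - wedgeMatrix u v)).rank = 2
      rw [sub_sub_cancel]
      exact rank_wedgeMatrix_of_rank_eq (Or.inr huv)
    exact ⟨.cons hadj p, by rw [SimpleGraph.Walk.length_cons, hp]⟩

theorem rank_sub_le_of_walk {X Y : altMatrices F n} (p : (altGraph F n).Walk X Y) :
    ((X - Y : altMatrices F n) : Matrix (Fin n) (Fin n) F).rank ≤ 2 * p.length := by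
  induction p with
  | nil => simp
  | @cons X Z Y h p ih =>
    have h1 : ((X : Matrix (Fin n) (Fin n) F) - (Z : Matrix (Fin n) (Fin n) F)).rank = 2 := h
    have h2 := rank_add_le_rank_add_rank
      ((X : Matrix (Fin n) (Fin n) F) - (Z : Matrix (Fin n) (Fin n) F))
      ((Z : Matrix (Fin n) (Fin n) F) - (Y : Matrix (Fin n) (Fin n) F))
    rw [sub_add_sub_cancel, h1] at h2
    rw [Submodule.coe_sub] at ih ⊢
    rw [SimpleGraph.Walk.length_cons]
    omega

/-- An edge changes the rank of the difference by at most two, and some edge lowers a nonzero rank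
by exactly two. -/
theorem edist_altGraph_eq_iff (X Y : altMatrices F n) (k : ℕ) :
    (altGraph F n).edist X Y = k ↔
      ((X - Y : altMatrices F n) : Matrix (Fin n) (Fin n) F).rank = 2 * k := by
  obtain ⟨r, hr⟩ := even_rank_of_mem_altMatrices (X - Y).2
  rw [← two_mul] at hr
  have h : (altGraph F n).edist X Y = r := by
    obtain ⟨p, hp⟩ := exists_walk_of_rank_sub_eq r X Y hr
    refine le_antisymm (hp ▸ p.edist_le) ?_
    refine le_iInf fun w => ?_
    have := rank_sub_le_of_walk w
    exact_mod_cast (by omega : r ≤ w.length)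
  rw [h, hr]
  norm_cast
  omega

theorem exists_rank_eq (k : ℕ) (hk : 2 * k ≤ n) :
    ∃ Z : altMatrices F n, (Z : Matrix (Fin n) (Fin n) F).rank = 2 * k := by
  induction k with
  | zero => exact ⟨0, by simp⟩
  | succ k ih =>
    obtain ⟨Z, hZ⟩ := ih (by omega)
    have hne : ∀ U : Submodule F (Fin n → F), Module.finrank F U < n → ∃ x, x ∉ U := by
      intro U hU
      by_contra! h
      rw [(Submodule.eq_top_iff').2 h, finrank_top, Module.finrank_fin_fun] at hU
      exact lt_irrefl _ hU
    have hW : Module.finrank F (colSpace (Z : Matrix (Fin n) (Fin n) F)) = 2 * k := hZ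
    obtain ⟨u, hu⟩ := hne (colSpace (Z : Matrix (Fin n) (Fin n) F)) (by omega)
    obtain ⟨v, hv⟩ := hne (colSpace (Z : Matrix (Fin n) (Fin n) F) ⊔ F ∙ u) (by
      rw [Submodule.finrank_sup_span_singleton hu]; omega)
    refine ⟨Z - ⟨wedgeMatrix u v, wedgeMatrix_mem u v⟩, ?_⟩
    have := (rank_sub_wedgeMatrix_eq_add_two_iff Z.2).2 ⟨hu, hv⟩
    rw [hZ] at this
    exact this

theorem ediam_altGraph (F : Type*) [Field F] (n : ℕ) :
    (altGraph F n).ediam = (n / 2 : ℕ) := by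
  refine le_antisymm (SimpleGraph.ediam_le_of_edist_le fun X Y => ?_) ?_
  · obtain ⟨r, hr⟩ := even_rank_of_mem_altMatrices (X - Y).2
    rw [← two_mul] at hr
    rw [(edist_altGraph_eq_iff X Y r).2 hr]
    have := rank_add_finrank_ker ((X - Y : altMatrices F n) : Matrix (Fin n) (Fin n) F)
    exact_mod_cast (by omega : r ≤ n / 2)
  · obtain ⟨Z, hZ⟩ := exists_rank_eq (F := F) (n := n) (n / 2) (by omega)
    rw [← (edist_altGraph_eq_iff Z 0 (n / 2)).2 (by rw [sub_zero, hZ])]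
    exact SimpleGraph.edist_le_ediam

end Distance

/-! ### The distance matrices and their recurrence -/

section DistanceMatrix

variable {F : Type*} [Field F] {n : ℕ}

/-- The distance-`k` matrix of the alternating forms graph, in terms of ranks. -/
noncomputable def altDistMatrix (F : Type*) [Field F] (n k : ℕ) :
    Matrix (altMatrices F n) (altMatrices F n) ℝ :=
  Matrix.of fun X Y =>
    if ((X - Y : altMatrices F n) : Matrix (Fin n) (Fin n) F).rank = 2 * k then 1 else 0

theorem altDistMatrix_apply (k : ℕ) (X Y : altMatrices F n) :
    altDistMatrix F n k X Y =
      if ((X - Y : altMatrices F n) : Matrix (Fin n) (Fin n) F).rank = 2 * k then 1 else 0 := rfl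

open Classical in
theorem altDistMatrix_zero : altDistMatrix F n 0 = 1 := by
  ext X Y
  rw [altDistMatrix_apply, Matrix.one_apply]
  congr 1
  rw [eq_iff_iff, mul_zero]
  constructor
  · exact fun h => sub_eq_zero.1 (Subtype.ext (matrix_eq_zero_of_rank_eq_zero h))
  · rintro rfl
    simp

theorem altDistMatrix_eq_zero {k : ℕ} (hk : n < 2 * k) : altDistMatrix F n k = 0 := by
  ext X Y
  rw [altDistMatrix_apply, if_neg, Matrix.zero_apply]
  have := rank_add_finrank_ker ((X - Y : altMatrices F n) : Matrix (Fin n) (Fin n) F)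
  omega

theorem rankTwoCount_eq_zero (Z : altMatrices F n) {t : ℕ}
    (h1 : t ≠ (Z : Matrix (Fin n) (Fin n) F).rank + 2)
    (h2 : t ≠ (Z : Matrix (Fin n) (Fin n) F).rank)
    (h3 : t + 2 ≠ (Z : Matrix (Fin n) (Fin n) F).rank) : rankTwoCount Z t = 0 := by
  rw [rankTwoCount, Nat.card_eq_zero]
  left
  refine ⟨?_⟩
  rintro ⟨X, hX, ht⟩
  rcases rank_sub_trichotomy Z X hX with h | h | h <;> omega

/-- Removes the parity of n: q^m and b^d are q^n and q^(n-1) in some order, and the expression is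
symmetric in them. -/
theorem sub_pow_mul_sub_pow_succ (q x : ℝ) (hn : 2 ≤ n) :
    (q ^ n - x) * (q ^ n - q * x) =
      q * ((q ^ (2 * n - 2 * (n / 2) - 1) - x) * ((q ^ 2) ^ (n / 2) - x)) := by
  rcases Nat.even_or_odd' n with ⟨c, rfl | rfl⟩
  · have e1 : 2 * c / 2 = c := by omega
    have e2 : 2 * (2 * c) - 2 * c - 1 = 2 * (c - 1) + 1 := by omega
    have e3 : 2 * c = 2 * (c - 1) + 1 + 1 := by omega
    rw [e1, e2, ← pow_mul, e3, pow_succ _ (2 * (c - 1) + 1)]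
    ring
  · have e1 : (2 * c + 1) / 2 = c := by omega
    have e2 : 2 * (2 * c + 1) - 2 * c - 1 = 2 * c + 1 := by omega
    rw [e1, e2, ← pow_mul, pow_succ]
    ring

open Classical in
theorem adjMatrix_altGraph : (altGraph F n).adjMatrix ℝ = altDistMatrix F n 1 := by
  ext X Y
  rw [SimpleGraph.adjMatrix_apply, altDistMatrix_apply]
  congr 1

variable [Fintype F]

open Classical in
theorem adjOperator_distanceGraph {k : ℕ} (hk : 1 ≤ k) :
    adjOperator (distanceGraph (altGraph F n) k) = (altDistMatrix F n k).mulVecLin := by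
  have h : (distanceGraph (altGraph F n) k).adjMatrix ℝ = altDistMatrix F n k := by
    ext X Y
    rw [SimpleGraph.adjMatrix_apply, altDistMatrix_apply]
    congr 1
    rw [eq_iff_iff]
    change (X ≠ Y ∧ _) ↔ _
    rw [edist_altGraph_eq_iff, and_iff_right_iff_imp]
    rintro h rfl
    rw [sub_self, Submodule.coe_zero, Matrix.rank_zero] at h
    omega
  rw [adjOperator, h]
  exact LinearMap.ext fun f => rfl

theorem altDistMatrix_one_mul_apply (k : ℕ) (X Y : altMatrices F n) :
    (altDistMatrix F n 1 * altDistMatrix F n k) X Y = rankTwoCount (X - Y) (2 * k) := by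
  classical
  rw [Matrix.mul_apply, rankTwoCount, Nat.card_eq_fintype_card, Fintype.card_subtype,
    Finset.card_filter, Nat.cast_sum, ← Equiv.sum_comp (Equiv.subLeft X)]
  refine Finset.sum_congr rfl fun Z _ => ?_
  rw [Equiv.subLeft_apply, altDistMatrix_apply, altDistMatrix_apply, sub_sub_cancel,
    sub_right_comm, ite_and, mul_one]
  split_ifs <;> simp

theorem rankTwoCount_total (Z : altMatrices F n)
    (h : 2 ≤ (Z : Matrix (Fin n) (Fin n) F).rank) :
    rankTwoCount Z ((Z : Matrix (Fin n) (Fin n) F).rank + 2) +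
      rankTwoCount Z (Z : Matrix (Fin n) (Fin n) F).rank +
      rankTwoCount Z ((Z : Matrix (Fin n) (Fin n) F).rank - 2) =
      rankTwoCount (0 : altMatrices F n) 2 := by
  classical
  simp only [rankTwoCount, Nat.card_eq_fintype_card, Fintype.card_subtype, Finset.card_filter]
  rw [← Finset.sum_add_distrib, ← Finset.sum_add_distrib]
  refine Finset.sum_congr rfl fun X _ => ?_
  have h0 : ((0 - X : altMatrices F n) : Matrix (Fin n) (Fin n) F).rank =
      (X : Matrix (Fin n) (Fin n) F).rank := by
    rw [zero_sub, Submodule.coe_neg, rank_neg_matrix]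
  rw [h0]
  by_cases hX : (X : Matrix (Fin n) (Fin n) F).rank = 2
  · have := rank_sub_trichotomy Z X hX
    simp only [hX, true_and, if_true]
    rcases this with h1 | h1 | h1
    · rw [if_pos h1, if_neg (by omega), if_neg (by omega)]
    · rw [if_neg (by omega), if_pos h1, if_neg (by omega)]
    · rw [if_neg (by omega), if_neg (by omega), if_pos (by omega)]
  · simp [hX]

theorem one_lt_card_field (F : Type*) [Field F] [Fintype F] : (1 : ℝ) < Fintype.card F := by
  exact_mod_cast Fintype.one_lt_card

section Values

variable (Z : altMatrices F n) {k : ℕ}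

theorem rankTwoCount_up (hn : 2 ≤ n)
    (hZ : (Z : Matrix (Fin n) (Fin n) F).rank = 2 * k) :
    let q : ℝ := Fintype.card F
    (q ^ 2 - 1) * rankTwoCount Z (2 * (k + 1)) =
      (q ^ (2 * n - 2 * (n / 2) - 1) - (q ^ 2) ^ k) * ((q ^ 2) ^ (n / 2) - (q ^ 2) ^ k) := by
  intro q
  have hq : q ≠ 0 := (zero_lt_one.trans (one_lt_card_field F)).ne'
  have h := rankTwoCount_add_two Z
  rw [hZ, show 2 * k + 2 = 2 * (k + 1) by ring] at h
  have h2 := sub_pow_mul_sub_pow_succ q ((q ^ 2) ^ k) hn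
  rw [← pow_mul q 2 k] at h2 ⊢
  apply mul_left_cancel₀ hq
  rw [← h2, ← pow_succ', ← h]
  ring

theorem rankTwoCount_down (hZ : (Z : Matrix (Fin n) (Fin n) F).rank = 2 * (k + 1)) :
    let q : ℝ := Fintype.card F
    (q ^ 2 - 1) * rankTwoCount Z (2 * k) = ((q ^ 2) ^ (k + 1) - 1) * (q ^ 2) ^ k := by
  intro q
  have hq : q ≠ 0 := (zero_lt_one.trans (one_lt_card_field F)).ne'
  have h := rankTwoCount_sub_two Z (t := 2 * k) (by rw [hZ]; ring)
  rw [show 2 * k + 2 = 2 * (k + 1) by ring, pow_mul] at h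
  apply mul_left_cancel₀ (pow_ne_zero 2 hq)
  change _ = ((q ^ 2) ^ (k + 1) - 1) * (q ^ 2) ^ (k + 1) at h
  rw [pow_succ (q ^ 2) k] at h ⊢
  linear_combination h

theorem rankTwoCount_same (hn : 2 ≤ n)
    (hZ : (Z : Matrix (Fin n) (Fin n) F).rank = 2 * (k + 1)) :
    let q : ℝ := Fintype.card F
    let Q : ℝ := q ^ (2 * n - 2 * (n / 2) - 1)
    (q ^ 2 - 1) * rankTwoCount Z (2 * (k + 1)) =
      (Q - 1) * ((q ^ 2) ^ (n / 2) - 1) -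
        (Q - (q ^ 2) ^ (k + 1)) * ((q ^ 2) ^ (n / 2) - (q ^ 2) ^ (k + 1)) -
        ((q ^ 2) ^ (k + 1) - 1) * (q ^ 2) ^ k := by
  intro q Q
  have h1 := rankTwoCount_total Z (by omega)
  rw [hZ, show 2 * (k + 1) + 2 = 2 * (k + 1 + 1) by ring,
    show 2 * (k + 1) - 2 = 2 * k by omega] at h1
  have h2 := rankTwoCount_up Z hn hZ
  have h3 := rankTwoCount_down Z hZ
  have h4 := rankTwoCount_up (0 : altMatrices F n) (k := 0) hn (by simp)
  have h5 : (rankTwoCount Z (2 * (k + 1 + 1)) : ℝ) + rankTwoCount Z (2 * (k + 1)) +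
      rankTwoCount Z (2 * k) = rankTwoCount (0 : altMatrices F n) 2 := by exact_mod_cast h1
  simp only [pow_zero, zero_add, mul_one] at h4
  linear_combination (q ^ 2 - 1) * h5 - h2 - h3 + h4

end Values

theorem altDistMatrix_recurrence (hn : 2 ≤ n) (j : ℕ) :
    let q : ℝ := Fintype.card F
    let Q : ℝ := q ^ (2 * n - 2 * (n / 2) - 1)
    let b := q ^ 2
    let d := n / 2
    (b - 1) • (altDistMatrix F n 1 * altDistMatrix F n (j + 1)) =
      ((Q - b ^ j) * (b ^ d - b ^ j)) • altDistMatrix F n j +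
      ((Q - 1) * (b ^ d - 1) - (Q - b ^ (j + 1)) * (b ^ d - b ^ (j + 1)) -
          (b ^ (j + 1) - 1) * b ^ j) • altDistMatrix F n (j + 1) +
        ((b ^ (j + 2) - 1) * b ^ (j + 1)) • altDistMatrix F n (j + 2) := by
  intro q Q b d
  ext X Y
  rw [Matrix.smul_apply, altDistMatrix_one_mul_apply, Matrix.add_apply, Matrix.add_apply,
    Matrix.smul_apply, Matrix.smul_apply, Matrix.smul_apply, altDistMatrix_apply,
    altDistMatrix_apply, altDistMatrix_apply]
  simp only [smul_eq_mul]
  obtain ⟨r, hr⟩ := even_rank_of_mem_altMatrices (X - Y).2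
  rw [← two_mul] at hr
  by_cases h1 : r = j
  · subst h1
    rw [rankTwoCount_up _ hn hr, if_pos hr, if_neg (by omega), if_neg (by omega)]
    ring
  by_cases h2 : r = j + 1
  · subst h2
    rw [rankTwoCount_same _ hn hr, if_neg (by omega), if_pos hr, if_neg (by omega)]
    ring
  by_cases h3 : r = j + 2
  · subst h3
    rw [rankTwoCount_down _ hr, if_neg (by omega), if_neg (by omega), if_pos hr]
    ring
  rw [rankTwoCount_eq_zero _ (by omega) (by omega) (by omega), if_neg (by omega),
    if_neg (by omega), if_neg (by omega)]
  simp

end DistanceMatrix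

/-! ### Three-term recurrences and polynomials -/

section Polynomials

open Polynomial

/-- The polynomials with `c X v (j + 1) = α j v j + β j v (j + 1) + γ j v (j + 2)`, `v 0 = 1` and
`v 1 = X`. -/
noncomputable def recurrencePoly (c : ℝ) (α β γ : ℕ → ℝ) : ℕ → ℝ[X]
  | 0 => 1
  | 1 => X
  | j + 2 => C (γ j)⁻¹ * (C c * X * recurrencePoly c α β γ (j + 1) -
      C (α j) * recurrencePoly c α β γ j - C (β j) * recurrencePoly c α β γ (j + 1))

variable {c : ℝ} {α β γ : ℕ → ℝ}

theorem recurrencePoly_degree (hc : c ≠ 0) (hγ : ∀ j, γ j ≠ 0) (j : ℕ) :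
    (recurrencePoly c α β γ j).natDegree ≤ j ∧ (recurrencePoly c α β γ j).coeff j ≠ 0 := by
  induction j using Nat.twoStepInduction with
  | zero => simp [recurrencePoly]
  | one => simp [recurrencePoly]
  | more j h1 h2 =>
    have e1 : (recurrencePoly c α β γ j).coeff (j + 2) = 0 :=
      coeff_eq_zero_of_natDegree_lt (by omega)
    have e2 : (recurrencePoly c α β γ (j + 1)).coeff (j + 2) = 0 :=
      coeff_eq_zero_of_natDegree_lt (by omega)
    constructor
    · rw [recurrencePoly]
      refine natDegree_C_mul_le _ _ |>.trans ?_
      refine (natDegree_sub_le_of_le (natDegree_sub_le_of_le (m := j + 2) (n := j + 2) ?_ ?_)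
        (n := j + 2) ?_).trans (by simp)
      · rw [mul_assoc]
        refine (natDegree_C_mul_le _ _).trans (natDegree_mul_le.trans ?_)
        rw [natDegree_X]
        omega
      · exact (natDegree_C_mul_le _ _).trans (by omega)
      · exact (natDegree_C_mul_le _ _).trans (by omega)
    · rw [recurrencePoly, coeff_C_mul, coeff_sub, coeff_sub, coeff_C_mul, coeff_C_mul, e1, e2,
        mul_assoc, coeff_C_mul, coeff_X_mul, mul_zero, mul_zero, sub_zero, sub_zero]
      exact mul_ne_zero (inv_ne_zero (hγ j)) (mul_ne_zero hc h2.2)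

/-- Stated for an arbitrary algebra because it serves twice: for the distance matrices and for the
real numbers A_j(i) with i fixed. -/
theorem aeval_recurrencePoly {A : Type*} [Ring A] [Algebra ℝ A] (hγ : ∀ j, γ j ≠ 0) {d : ℕ}
    {T : ℕ → A} (h0 : T 0 = 1)
    (hT : ∀ j, j + 1 ≤ d →
      c • (T 1 * T (j + 1)) = α j • T j + β j • T (j + 1) + γ j • T (j + 2))
    (j : ℕ) (hj : j ≤ d + 1) : aeval (T 1) (recurrencePoly c α β γ j) = T j := by
  induction j using Nat.twoStepInduction with
  | zero => simp [recurrencePoly, h0]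
  | one => simp [recurrencePoly]
  | more j h1 h2 =>
    have h := hT j (by omega)
    rw [recurrencePoly]
    simp only [map_mul, map_sub, aeval_C, aeval_X, h1 (by omega), h2 (by omega), mul_assoc,
      ← Algebra.smul_def]
    rw [h]
    have : α j • T j + β j • T (j + 1) + γ j • T (j + 2) - α j • T j - β j • T (j + 1) =
        γ j • T (j + 2) := by abel
    rw [this, smul_smul, inv_mul_cancel₀ (hγ j), one_smul]

end Polynomials

/-! ### Spaces spanned by eigenspaces -/

section Eigenspaces

open Polynomial

variable {M : Type*} [AddCommGroup M] [Module ℝ M]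

theorem ker_aeval_prod_le_iSup_eigenspace (f : Module.End ℝ M) {θ : ℕ → ℝ} (s : Finset ℕ)
    (hθ : Set.InjOn θ s) :
    LinearMap.ker (aeval f (∏ i ∈ s, (X - C (θ i)))) ≤ ⨆ i ∈ s, f.eigenspace (θ i) := by
  classical
  induction s using Finset.induction_on with
  | empty =>
    simp only [Finset.prod_empty, map_one]
    intro x hx
    simpa using hx
  | insert a s ha ih =>
    have hcop : IsCoprime (X - C (θ a)) (∏ i ∈ s, (X - C (θ i))) := by
      refine IsCoprime.prod_right fun i hi => ?_
      refine isCoprime_X_sub_C_of_isUnit_sub ?_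
      refine (sub_ne_zero.2 fun h => ?_).isUnit
      have := hθ (Finset.mem_insert_self a s) (Finset.mem_insert_of_mem hi) h
      exact ha (this ▸ hi)
    rw [Finset.prod_insert ha, ← sup_ker_aeval_eq_ker_aeval_mul_of_coprime f hcop,
      Finset.iSup_insert]
    refine sup_le_sup ?_ (ih (hθ.mono (by simp)))
    intro x hx
    rw [Module.End.mem_eigenspace_iff]
    simpa [sub_eq_zero, Module.algebraMap_end_apply] using hx

theorem aeval_prod_eq_zero_of_iSup_eigenspace (f : Module.End ℝ M) {θ : ℕ → ℝ} (s : Finset ℕ)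
    (h : ⨆ i ∈ s, f.eigenspace (θ i) = ⊤) :
    aeval f (∏ i ∈ s, (X - C (θ i))) = 0 := by
  rw [← LinearMap.ker_eq_top, eq_top_iff, ← h]
  refine iSup₂_le fun i hi x hx => ?_
  rw [Module.End.mem_eigenspace_iff] at hx
  rw [LinearMap.mem_ker, ← Finset.prod_erase_mul s _ hi, map_mul, Module.End.mul_apply]
  have : aeval f (X - C (θ i)) x = 0 := by
    simpa [sub_eq_zero, Module.algebraMap_end_apply] using hx
  rw [this, map_zero]

end Eigenspaces

/-! ### The spectrum of the alternating forms graph -/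

section Spectrum

open Polynomial

variable {F : Type*} [Field F] [Fintype F] {n : ℕ}

theorem aeval_mulVecLin {V : Type*} [Fintype V] [DecidableEq V] (A : Matrix V V ℝ) (p : ℝ[X]) :
    aeval A.mulVecLin p = Matrix.toLinAlgEquiv' (aeval A p) :=
  aeval_algHom_apply (Matrix.toLinAlgEquiv' : Matrix V V ℝ ≃ₐ[ℝ] _).toAlgHom A p

/-- A polynomial of degree `k` in the adjacency matrix does not vanish if `2 k ≤ n`. -/
theorem aeval_altDistMatrix_ne_zero {p : ℝ[X]} (hp : p ≠ 0) (hk : 2 * p.natDegree ≤ n) :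
    aeval (Matrix.mulVecLin (altDistMatrix F n 1)) p ≠ 0 := by
  classical
  intro h
  have h1 : aeval (altDistMatrix F n 1) p = 0 := by
    rw [aeval_mulVecLin] at h
    exact (map_eq_zero_iff _ (AlgEquiv.injective _)).1 h
  -- Z is at distance deg p from 0. Walks of smaller length do not reach it, so only the leading
  -- term contributes to the entry (Z, 0).
  obtain ⟨Z, hZ⟩ := exists_rank_eq (F := F) p.natDegree hk
  have h3 : (aeval (altDistMatrix F n 1) p) Z 0 = 0 := by rw [h1, Matrix.zero_apply]
  have hw : ∀ k, (altDistMatrix F n 1 ^ k) Z 0 =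
      Fintype.card {w : (altGraph F n).Walk Z 0 | w.length = k} := fun k => by
    rw [← adjMatrix_altGraph]
    convert SimpleGraph.adjMatrix_pow_apply_eq_card_walk (G := altGraph F n) (α := ℝ) k Z 0
  rw [aeval_eq_sum_range, Matrix.sum_apply, Finset.sum_eq_single p.natDegree] at h3
  · rw [Matrix.smul_apply, hw, smul_eq_mul, mul_eq_zero] at h3
    rcases h3 with h3 | h3
    · exact hp (leadingCoeff_eq_zero.1 h3)
    · obtain ⟨w, hwl⟩ := exists_walk_of_rank_sub_eq p.natDegree Z 0 (by rw [sub_zero, hZ])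
      rw [Nat.cast_eq_zero, Fintype.card_eq_zero_iff] at h3
      exact h3.false ⟨w, hwl⟩
  · intro k hk hkn
    rw [Matrix.smul_apply, hw, smul_eq_mul, mul_eq_zero]
    right
    rw [Nat.cast_eq_zero, Fintype.card_eq_zero_iff]
    refine ⟨fun w => ?_⟩
    have h4 := rank_sub_le_of_walk w.1
    have h5 : w.1.length = k := w.2
    rw [sub_zero, hZ, h5] at h4
    have := Finset.mem_range.1 hk
    omega
  · simp

theorem pow_le_mul_pow {q : ℝ} (hq : 1 ≤ q) (hn : 2 ≤ n) :
    (q ^ 2) ^ (n / 2) ≤ q * q ^ (2 * n - 2 * (n / 2) - 1) := by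
  rw [← pow_mul, ← pow_succ']
  exact pow_le_pow_right₀ hq (by omega)

variable (F n) in
/-- The numbers `altKrawtchouk` with the parameters of the alternating forms graph. -/
noncomputable def altEigen (j i : ℕ) : ℝ :=
  altKrawtchouk (Fintype.card F) ((Fintype.card F : ℝ) ^ (2 * n - 2 * (n / 2) - 1)) (n / 2) j i

theorem two_le_card_field (F : Type*) [Field F] [Fintype F] : (2 : ℝ) ≤ Fintype.card F := by
  exact_mod_cast Fintype.one_lt_card (α := F)

theorem altEigen_one_lt (hn : 2 ≤ n) {i : ℕ} (hi : i + 1 ≤ n / 2) :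
    altEigen F n 1 (i + 1) < altEigen F n 1 i := by
  have hq := two_le_card_field F
  have h := altKrawtchouk_sub_succ_sign hq (pow_le_mul_pow (by linarith) hn) le_rfl
    (by omega : 1 ≤ n / 2) hi
  rw [min_eq_left (by omega), Nat.sub_self, pow_zero, one_mul] at h
  exact sub_pos.1 h

theorem altEigen_one_injOn (hn : 2 ≤ n) :
    Set.InjOn (altEigen F n 1) (Finset.range (n / 2 + 1) : Set ℕ) := by
  have : StrictAntiOn (altEigen F n 1) (Set.Iic (n / 2)) := by
    refine strictAntiOn_of_succ_lt Set.ordConnected_Iic fun i _ _ hi => ?_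
    exact altEigen_one_lt hn hi
  refine this.injOn.mono fun i hi => ?_
  simp only [Finset.coe_range, Set.mem_Iio] at hi
  exact Nat.lt_succ_iff.1 hi

variable (F n) in
/-- The polynomials expressing the distance matrices by the adjacency matrix. -/
noncomputable def altDistPoly : ℕ → ℝ[X] :=
  let q : ℝ := Fintype.card F
  let Q : ℝ := q ^ (2 * n - 2 * (n / 2) - 1)
  let b := q ^ 2
  let d := n / 2
  recurrencePoly (b - 1) (fun j => (Q - b ^ j) * (b ^ d - b ^ j))
    (fun j => (Q - 1) * (b ^ d - 1) - (Q - b ^ (j + 1)) * (b ^ d - b ^ (j + 1)) -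
          (b ^ (j + 1) - 1) * b ^ j)
    (fun j => (b ^ (j + 2) - 1) * b ^ (j + 1))

theorem one_lt_card_sq (F : Type*) [Field F] [Fintype F] : (1 : ℝ) < (Fintype.card F : ℝ) ^ 2 :=
  one_lt_pow₀ (one_lt_card_field F) two_ne_zero

theorem altDistPoly_gamma_ne_zero (F : Type*) [Field F] [Fintype F] (j : ℕ) :
    (((Fintype.card F : ℝ) ^ 2) ^ (j + 2) - 1) * ((Fintype.card F : ℝ) ^ 2) ^ (j + 1) ≠ 0 := by
  have hb := one_lt_card_sq F
  exact mul_ne_zero (pow_succ_sub_one_pos hb (j + 1)).ne' (by positivity)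

open Classical in
theorem aeval_altDistPoly_matrix (hn : 2 ≤ n) {j : ℕ} (hj : j ≤ n / 2 + 1) :
    aeval (altDistMatrix F n 1) (altDistPoly F n j) = altDistMatrix F n j :=
  aeval_recurrencePoly (d := n / 2) (T := altDistMatrix F n) (altDistPoly_gamma_ne_zero F)
    altDistMatrix_zero (fun j _ => altDistMatrix_recurrence hn j) j hj

theorem aeval_altDistPoly (hn : 2 ≤ n) {j : ℕ} (hj : j ≤ n / 2 + 1) :
    aeval (Matrix.mulVecLin (altDistMatrix F n 1)) (altDistPoly F n j) =
      Matrix.mulVecLin (altDistMatrix F n j) := by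
  classical
  rw [aeval_mulVecLin, aeval_altDistPoly_matrix hn hj]
  rfl

theorem eval_altDistPoly {i j : ℕ} (hi : i ≤ n / 2) (hj : j ≤ n / 2 + 1) :
    (altDistPoly F n j).eval (altEigen F n 1 i) = altEigen F n j i := by
  rw [← coe_aeval_eq_eval]
  refine aeval_recurrencePoly (d := n / 2) (T := fun j => altEigen F n j i)
    (altDistPoly_gamma_ne_zero F) (altKrawtchouk_zero _ _ _ _) (fun j hj => ?_) j hj
  have h1 := altKrawtchouk_recurrence (Q := (Fintype.card F : ℝ) ^ (2 * n - 2 * (n / 2) - 1))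
    (one_lt_card_field F) hi hj
  have h2 := altKrawtchouk_one (Q := (Fintype.card F : ℝ) ^ (2 * n - 2 * (n / 2) - 1))
    (one_lt_card_field F) (n / 2) i
  simp only [smul_eq_mul]
  rw [← mul_assoc]
  unfold altEigen
  rw [h2]
  exact h1

/-- The polynomial of index d + 1 has degree at most d + 1 and the d + 1 distinct roots A_1(i), so
it is a nonzero constant times this product; it annihilates the adjacency matrix since no two
vertices are at distance d + 1. -/
theorem aeval_prod_altEigen (hn : 2 ≤ n) :
    aeval (Matrix.mulVecLin (altDistMatrix F n 1))
      (∏ i ∈ Finset.range (n / 2 + 1), (X - C (altEigen F n 1 i))) = 0 := by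
  have hdeg := recurrencePoly_degree (c := (Fintype.card F : ℝ) ^ 2 - 1)
    (α := fun j => ((Fintype.card F : ℝ) ^ (2 * n - 2 * (n / 2) - 1) -
      ((Fintype.card F : ℝ) ^ 2) ^ j) * (((Fintype.card F : ℝ) ^ 2) ^ (n / 2) -
      ((Fintype.card F : ℝ) ^ 2) ^ j))
    (β := fun j => ((Fintype.card F : ℝ) ^ (2 * n - 2 * (n / 2) - 1) - 1) *
      (((Fintype.card F : ℝ) ^ 2) ^ (n / 2) - 1) -
      ((Fintype.card F : ℝ) ^ (2 * n - 2 * (n / 2) - 1) -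
      ((Fintype.card F : ℝ) ^ 2) ^ (j + 1)) * (((Fintype.card F : ℝ) ^ 2) ^ (n / 2) -
      ((Fintype.card F : ℝ) ^ 2) ^ (j + 1)) -
      (((Fintype.card F : ℝ) ^ 2) ^ (j + 1) - 1) * ((Fintype.card F : ℝ) ^ 2) ^ j)
    (sub_ne_zero.2 (one_lt_card_sq F).ne') (altDistPoly_gamma_ne_zero F) (n / 2 + 1)
  change (altDistPoly F n (n / 2 + 1)).natDegree ≤ _ ∧
    (altDistPoly F n (n / 2 + 1)).coeff _ ≠ 0 at hdeg
  set N := ∏ i ∈ Finset.range (n / 2 + 1), (X - C (altEigen F n 1 i)) with hN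
  have hNdeg : N.natDegree = n / 2 + 1 := by
    rw [hN, natDegree_prod_of_monic _ _ fun i _ => monic_X_sub_C _]
    simp
  have hdvd : N ∣ altDistPoly F n (n / 2 + 1) := by
    refine Finset.prod_dvd_of_coprime (fun i hi k hk hik => ?_) fun i hi => ?_
    · refine isCoprime_X_sub_C_of_isUnit_sub (sub_ne_zero.2 fun h => hik ?_).isUnit
      exact altEigen_one_injOn hn hi hk h
    · rw [dvd_iff_isRoot, IsRoot.def,
        eval_altDistPoly (Nat.lt_succ_iff.1 (Finset.mem_range.1 hi)) le_rfl]
      exact altKrawtchouk_eq_zero i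
  obtain ⟨r, hr⟩ := hdvd
  have hne : altDistPoly F n (n / 2 + 1) ≠ 0 := by
    intro h
    rw [h, coeff_zero] at hdeg
    exact hdeg.2 rfl
  have hr0 : r ≠ 0 := by
    rintro rfl
    rw [mul_zero] at hr
    exact hne hr
  have hN0 : N ≠ 0 := by
    intro h
    rw [h, zero_mul] at hr
    exact hne hr
  have hrdeg : r.natDegree = 0 := by
    have := natDegree_mul hN0 hr0
    rw [← hr, hNdeg] at this
    omega
  obtain ⟨ρ, rfl⟩ := natDegree_eq_zero.1 hrdeg
  have hρ : ρ ≠ 0 := by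
    rintro rfl
    exact hr0 C_0
  have h := aeval_altDistPoly (F := F) hn (le_refl (n / 2 + 1))
  rw [altDistMatrix_eq_zero (k := n / 2 + 1) (by omega), Matrix.mulVecLin_zero, hr, mul_comm,
    ← smul_eq_C_mul, map_smul] at h
  exact (smul_eq_zero.1 h).resolve_left hρ

theorem iSup_eigenspace_altDistMatrix (hn : 2 ≤ n) :
    ⨆ i ∈ Finset.range (n / 2 + 1),
      Module.End.eigenspace (Matrix.mulVecLin (altDistMatrix F n 1)) (altEigen F n 1 i) = ⊤ := by
  refine top_le_iff.1 (le_trans ?_ (ker_aeval_prod_le_iSup_eigenspace _ _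
    (altEigen_one_injOn hn)))
  rw [aeval_prod_altEigen hn, LinearMap.ker_zero]

/-- Otherwise the product over the remaining indices, of degree only d, would annihilate the
adjacency matrix. -/
theorem eigenspace_altDistMatrix_ne_bot (hn : 2 ≤ n) {i : ℕ} (hi : i ≤ n / 2) :
    Module.End.eigenspace (Matrix.mulVecLin (altDistMatrix F n 1)) (altEigen F n 1 i) ≠ ⊥ := by
  intro h
  have h1 := iSup_eigenspace_altDistMatrix (F := F) hn
  rw [← Finset.insert_erase (Finset.mem_range.2 (Nat.lt_succ_iff.2 hi)), Finset.iSup_insert, h,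
    bot_sup_eq] at h1
  have hmonic : (∏ k ∈ (Finset.range (n / 2 + 1)).erase i, (X - C (altEigen F n 1 k))).Monic :=
    monic_prod_of_monic _ _ fun k _ => monic_X_sub_C _
  refine aeval_altDistMatrix_ne_zero hmonic.ne_zero ?_
    (aeval_prod_eq_zero_of_iSup_eigenspace _ _ h1)
  rw [natDegree_prod_of_monic _ _ fun k _ => monic_X_sub_C _]
  simp only [natDegree_X_sub_C, Finset.sum_const, smul_eq_mul, mul_one]
  rw [Finset.card_erase_of_mem (Finset.mem_range.2 (Nat.lt_succ_iff.2 hi)), Finset.card_range]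
  omega

theorem eigenspace_altDistMatrix_le (hn : 2 ≤ n) {i j : ℕ} (hi : i ≤ n / 2) (hj : j ≤ n / 2) :
    Module.End.eigenspace (Matrix.mulVecLin (altDistMatrix F n 1)) (altEigen F n 1 i) ≤
      Module.End.eigenspace (Matrix.mulVecLin (altDistMatrix F n j)) (altEigen F n j i) := by
  intro x hx
  rw [Module.End.mem_eigenspace_iff]
  rcases eq_or_ne x 0 with rfl | hx0
  · simp
  rw [← aeval_altDistPoly hn (by omega), Module.End.aeval_apply_of_hasEigenvector ⟨hx, hx0⟩,
    eval_altDistPoly hi (by omega)]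

/-- The joint eigenspaces of the distance matrices. -/
theorem iInf_eigenspace_altGraph (hn : 2 ≤ n) {i : ℕ} (hi : i ≤ n / 2) :
    (⨅ j ∈ Set.Icc 1 (n / 2),
      (adjOperator (distanceGraph (altGraph F n) j)).eigenspace (altEigen F n j i)) =
    Module.End.eigenspace (Matrix.mulVecLin (altDistMatrix F n 1)) (altEigen F n 1 i) := by
  refine le_antisymm ?_ (le_iInf₂ fun j hj => ?_)
  · refine (iInf₂_le 1 ⟨le_rfl, by omega⟩).trans ?_
    rw [adjOperator_distanceGraph le_rfl]
  · rw [adjOperator_distanceGraph hj.1]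
    exact eigenspace_altDistMatrix_le hn hi hj.2

theorem isEigenmatrix_altGraph (hn : 2 ≤ n) :
    IsEigenmatrix (altGraph F n) (n / 2) (fun i l => altEigen F n l i) := by
  refine ⟨ediam_altGraph F n, fun i _ => altKrawtchouk_zero _ _ _ _,
    fun i hi => altEigen_one_lt hn hi, fun i hi => ?_, ?_⟩
  · rw [iInf_eigenspace_altGraph hn hi]
    exact eigenspace_altDistMatrix_ne_bot hn hi
  · rw [← top_le_iff, ← iSup_eigenspace_altDistMatrix (F := F) hn]
    refine iSup₂_le fun i hi => ?_
    have hi' : i ≤ n / 2 := Nat.lt_succ_iff.1 (Finset.mem_range.1 hi)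
    rw [← iInf_eigenspace_altGraph hn hi']
    exact le_iSup₂_of_le i hi' le_rfl

end Spectrum

/-- Eigenspaces for distinct values are independent, and those for the entries of column j already
span, leaving no room for a further eigenvalue. -/
theorem IsEigenmatrix.hasEigenvalue_iff {V : Type*} [Fintype V] {G : SimpleGraph V} {d : ℕ}
    {P : ℕ → ℕ → ℝ} (h : IsEigenmatrix G d P) {j : ℕ} (hj : 1 ≤ j) (hjd : j ≤ d) (θ : ℝ) :
    (adjOperator (distanceGraph G j)).HasEigenvalue θ ↔ ∃ i ≤ d, θ = P i j := by
  obtain ⟨-, -, -, hne, htop⟩ := h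
  constructor
  · intro hθ
    by_contra! hP
    refine hθ ?_
    have hind := (adjOperator (distanceGraph G j)).eigenspaces_iSupIndep θ
    refine hind.eq_bot_of_le (le_top.trans ?_)
    rw [← htop]
    refine iSup₂_le fun i hi => (iInf₂_le j ⟨hj, hjd⟩).trans ?_
    exact le_iSup₂_of_le (P i j) (hP i hi).symm le_rfl
  · rintro ⟨i, hi, rfl⟩
    intro hbot
    exact hne i hi (le_bot_iff.1 ((iInf₂_le j ⟨hj, hjd⟩).trans hbot.le))

/-! ### Extremal values -/

section Extremal

variable {q Q : ℝ} {d j i : ℕ}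

theorem abs_altKrawtchouk_le_of_le (hq : 2 ≤ q) (hQ : (q ^ 2) ^ d ≤ q * Q) (hj : 1 ≤ j)
    (hjd : j ≤ d) {i' : ℕ} (hii : i ≤ i') (hi' : i' + 1 ≤ d) :
    |altKrawtchouk q Q d j i'| ≤ |altKrawtchouk q Q d j i| := by
  induction i', hii using Nat.le_induction with
  | base => exact le_rfl
  | succ k _ ih =>
    exact (abs_altKrawtchouk_succ_lt hq hQ hj hjd (by omega) (Or.inl (by omega))).le.trans
      (ih (by omega))

theorem altKrawtchouk_neg (hq : 2 ≤ q) (hQ : (q ^ 2) ^ d ≤ q * Q) (hj : 1 ≤ j) (hjd : j ≤ d) :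
    altKrawtchouk q Q d j (d - j + 1) < 0 := by
  have h := altKrawtchouk_sign (i := d - j + 1) hq hQ hjd
  have e : j - min j (d - (d - j + 1)) = 1 := by omega
  rw [e] at h
  linarith

/-- The smallest of the numbers `altKrawtchouk q Q d j i`. -/
theorem altKrawtchouk_min_le (hq : 2 ≤ q) (hQ : (q ^ 2) ^ d ≤ q * Q) (hj : 1 ≤ j) (hjd : j ≤ d)
    (hi : i ≤ d) : altKrawtchouk q Q d j (d - j + 1) ≤ altKrawtchouk q Q d j i := by
  have hneg := altKrawtchouk_neg hq hQ hj hjd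
  -- The values are positive for i ≤ d - j and negative at d - j + 1; from there up to d - 1 the
  -- absolute values decrease. Only i = d needs a separate argument.
  rcases le_or_gt i (d - j) with h | h
  · have hs := altKrawtchouk_sign (i := i) hq hQ hjd
    rw [min_eq_left (by omega), Nat.sub_self, pow_zero, one_mul] at hs
    linarith
  rcases eq_or_lt_of_le hi with rfl | hid
  · rcases eq_or_lt_of_le hj with rfl | hj2
    · rw [Nat.sub_add_cancel hjd]
    rcases Nat.even_or_odd j with he | ho
    · have hs := altKrawtchouk_sign (i := i) hq hQ hjd
      rw [Nat.sub_self, Nat.min_zero, Nat.sub_zero, he.neg_one_pow, one_mul] at hs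
      linarith
    -- j ≥ 3 ensures d - 2 ≥ d - j + 1, so the value at d - 2 lies in the decreasing range, and the
    -- value at d exceeds it.
    · have hj3 : 3 ≤ j := by
        obtain ⟨k, rfl⟩ := ho
        omega
      obtain ⟨e, he⟩ : ∃ e, e + 2 = i := ⟨i - 2, by omega⟩
      have h1 := altKrawtchouk_sub_last_sign hq hQ hj2 hjd he
      rw [ho.neg_one_pow] at h1
      have h2 := abs_altKrawtchouk_le_of_le (i := i - j + 1) (i' := e) hq hQ hj hjd
        (by omega) (by omega)
      rw [abs_of_neg hneg] at h2
      have h3 := neg_abs_le (altKrawtchouk q Q i j e)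
      linarith
  · have h2 := abs_altKrawtchouk_le_of_le (i := d - j + 1) (i' := i) hq hQ hj hjd
      (by omega) (by omega)
    rw [abs_of_neg hneg] at h2
    have h3 := neg_abs_le (altKrawtchouk q Q d j i)
    linarith

/-- Skips the index d - 1, so it holds in the exceptional case too. For j ≥ 2 the difference of the
two values has the sign of A_j(d); j = 1 is done with the closed form. -/
theorem abs_altKrawtchouk_last_le (hq : 2 ≤ q) (hQ : (q ^ 2) ^ d ≤ q * Q) (hj : 1 ≤ j)
    (hjd : j ≤ d) (hi : i + 2 = d) :
    |altKrawtchouk q Q d j d| ≤ |altKrawtchouk q Q d j i| := by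
  rcases eq_or_lt_of_le hj with rfl | hj2
  · have hb : 4 ≤ q ^ 2 := by nlinarith
    have h1 := altKrawtchouk_one (Q := Q) (by linarith : 1 < q) d i
    have h2 := altKrawtchouk_one (Q := Q) (by linarith : 1 < q) d d
    have e : d - i = 2 := by omega
    rw [e] at h1
    rw [Nat.sub_self, pow_zero, sub_self, mul_zero, zero_sub] at h2
    have hd1 : 1 ≤ (q ^ 2) ^ d := one_le_pow₀ (by linarith)
    have h3 : 2 * (q ^ 2) ^ d ≤ Q * ((q ^ 2) ^ 2 - 1) := by
      have hQ0 := pos_of_pow_le_mul hq hQ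
      have : 2 * q ≤ (q ^ 2) ^ 2 - 1 := by nlinarith
      calc 2 * (q ^ 2) ^ d ≤ 2 * (q * Q) := by linarith
        _ = Q * (2 * q) := by ring
        _ ≤ _ := by gcongr
    have hb1 : 0 < q ^ 2 - 1 := by linarith
    refine le_of_mul_le_mul_left ?_ hb1
    rw [← abs_of_pos hb1, ← abs_mul, ← abs_mul, h1, h2, abs_neg,
      abs_of_nonneg (by linarith), abs_of_nonneg (by linarith)]
    linarith
  · have h1 := altKrawtchouk_sub_last_sign hq hQ hj2 hjd hi
    have h2 := altKrawtchouk_sign (i := d) hq hQ hjd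
    rw [Nat.sub_self, Nat.min_zero, Nat.sub_zero] at h2
    have h3 : ∀ x : ℝ, |(-1 : ℝ) ^ j * x| = |x| := fun x => by simp [abs_mul]
    rw [← h3, ← h3 (altKrawtchouk q Q d j i), abs_of_pos h2]
    refine le_trans ?_ (le_abs_self _)
    linarith

theorem two_mul_pow_sub_one_lt {n q : ℕ} (hq : 2 ≤ q) (hn : 2 ≤ n)
    (h : ¬ (q = 2 ∧ n = 2 * (n / 2))) :
    2 * (((q : ℝ) ^ 2) ^ (n / 2) - 1) <
      ((q : ℝ) ^ 2 - 1) * (q : ℝ) ^ (2 * n - 2 * (n / 2) - 1) := by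
  have hq' : (2 : ℝ) ≤ q := by exact_mod_cast hq
  have hQ := pow_le_mul_pow (n := n) (q := (q : ℝ)) (by linarith) hn
  have hQ0 : (0 : ℝ) < (q : ℝ) ^ (2 * n - 2 * (n / 2) - 1) := by positivity
  by_cases hn2 : n = 2 * (n / 2)
  · have hq3 : (3 : ℝ) ≤ q := by
      have : 3 ≤ q := by
        by_contra hlt
        exact h ⟨by omega, hn2⟩
      exact_mod_cast this
    have : 2 * (q : ℝ) ≤ (q : ℝ) ^ 2 - 1 := by nlinarith
    nlinarith
  · have e : 2 * n - 2 * (n / 2) - 1 = 2 * (n / 2) + 1 := by omega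
    rw [e, pow_succ _ (2 * (n / 2)), pow_mul]
    have hE : 0 < ((q : ℝ) ^ 2) ^ (n / 2) := by positivity
    have : 2 ≤ ((q : ℝ) ^ 2 - 1) * q := by nlinarith
    nlinarith

end Extremal

/-! ### Assembly of the main theorem -/

theorem IsEigenmatrix.congr {V : Type*} [Fintype V] {G : SimpleGraph V} {d : ℕ} {P P' : ℕ → ℕ → ℝ}
    (h : IsEigenmatrix G d P) (hd : 1 ≤ d) (hP : ∀ i ≤ d, ∀ j ≤ d, P' i j = P i j) :
    IsEigenmatrix G d P' := by
  obtain ⟨h1, h2, h3, h4, h5⟩ := h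
  have hinf : ∀ i ≤ d, (⨅ j ∈ Set.Icc 1 d, (adjOperator (distanceGraph G j)).eigenspace (P' i j)) =
      ⨅ j ∈ Set.Icc 1 d, (adjOperator (distanceGraph G j)).eigenspace (P i j) := fun i hi =>
    biInf_congr fun j hj => by rw [hP i hi j hj.2]
  refine ⟨h1, fun i hi => ?_, fun i hi => ?_, fun i hi => ?_, ?_⟩
  · rw [hP i hi 0 (by omega), h2 i hi]
  · rw [hP i (by omega) 1 hd, hP (i + 1) hi 1 hd]
    exact h3 i hi
  · rw [hinf i hi]
    exact h4 i hi
  · rw [← h5]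
    exact biSup_congr hinf

theorem mainTheorem9 {F : Type*} [Field F] [Fintype F] (q n d j : ℕ)
    (hq : q = Fintype.card F) (hd : d = n / 2) (hj : 1 ≤ j) (hjd : j ≤ d) :
    -- the numbers `A_j(i)` are the entries of the eigenmatrix of the alternating forms graph
    IsEigenmatrix (altGraph F n) d (fun i l => altEigenvalue q n l i) ∧
    -- (i)
    IsLeast {x : ℝ | ∃ i, 0 ≤ i ∧ i ≤ d ∧ x = altEigenvalue q n j i}
      (altEigenvalue q n j (d - j + 1)) ∧
    IsLeast {θ : ℝ | (adjOperator (distanceGraph (altGraph F n) j)).HasEigenvalue θ}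
      (altEigenvalue q n j (d - j + 1)) ∧
    -- (ii)
    (IsGreatest {x : ℝ | ∃ i, 1 ≤ i ∧ i ≤ d ∧ x = |altEigenvalue q n j i|}
        |altEigenvalue q n j 1| ↔
      ¬ (q = 2 ∧ n = 4 ∧ j = 1)) ∧
    -- (iii)
    (∀ i, 0 ≤ i → i + 1 ≤ d →
      (|altEigenvalue q n j i| < |altEigenvalue q n j (i + 1)| ↔
        (q = 2 ∧ n = 2 * d ∧ i + 1 = d) ∧ 1 ≤ j ∧ j + 1 ≤ d) ∧
      (|altEigenvalue q n j i| = |altEigenvalue q n j (i + 1)| ↔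
        (q = 2 ∧ n = 2 * d ∧ i + 1 = d) ∧ j = d) ∧
      (¬ (q = 2 ∧ n = 2 * d ∧ i + 1 = d) →
        |altEigenvalue q n j (i + 1)| < |altEigenvalue q n j i|)) := by
  have hn : 2 ≤ n := by omega
  have hq2 : 2 ≤ q := by
    rw [hq]
    exact Fintype.one_lt_card
  have hqR : (2 : ℝ) ≤ q := by exact_mod_cast hq2
  have hQ : ((q : ℝ) ^ 2) ^ d ≤ q * (q : ℝ) ^ (2 * n - 2 * (n / 2) - 1) := by
    rw [hd]
    exact pow_le_mul_pow (by linarith) hn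
  have hA : ∀ i, ∀ l ≤ d, altEigenvalue q n l i =
      altKrawtchouk q ((q : ℝ) ^ (2 * n - 2 * (n / 2) - 1)) d l i := fun i l hl => by
    rw [altEigenvalue_eq_altKrawtchouk hq2 (hd ▸ hl), hd]
  have hE : IsEigenmatrix (altGraph F n) d (fun i l => altEigenvalue q n l i) := by
    have h := isEigenmatrix_altGraph (F := F) hn
    rw [← hd] at h
    refine h.congr (by omega) fun i _ l hl => ?_
    simp only [altEigen]
    rw [hA i l hl, ← hq, hd]
  have hmin : ∀ i ≤ d, altEigenvalue q n j (d - j + 1) ≤ altEigenvalue q n j i := fun i hi => by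
    rw [hA _ _ hjd, hA _ _ hjd]
    exact altKrawtchouk_min_le hqR hQ hj hjd hi
  have hc : ∀ i, i + 1 ≤ d → ¬ (q = 2 ∧ n = 2 * d ∧ i + 1 = d) →
      |altEigenvalue q n j (i + 1)| < |altEigenvalue q n j i| := fun i hi hne => by
    rw [hA _ _ hjd, hA _ _ hjd]
    refine abs_altKrawtchouk_succ_lt hqR hQ hj hjd hi ?_
    by_cases hid : i + 1 = d
    · right
      rw [hd]
      exact two_mul_pow_sub_one_lt hq2 hn fun h => hne ⟨h.1, by rw [hd]; exact h.2, hid⟩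
    · exact Or.inl hid
  have hab : ∀ i, (q = 2 ∧ n = 2 * d ∧ i + 1 = d) → ∃ u : ℝ, 0 < u ∧
      |altEigenvalue q n j (i + 1)| - |altEigenvalue q n j i| = u * ((4 : ℝ) ^ d - 4 ^ j) := by
    rintro i ⟨h2, hnd, hid⟩
    rw [hA _ _ hjd, hA _ _ hjd, hid, h2]
    refine abs_altKrawtchouk_last ?_ hj hjd hid
    -- In the exceptional case m = 2d - 1, so that 2Q = 4^d.
    have e : 2 * n - 2 * (n / 2) - 1 + 1 = 2 * d := by omega
    rw [Nat.cast_ofNat, ← pow_succ', e, pow_mul]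
    norm_num
  have h4 : ∀ {k : ℕ}, k < d → (0 : ℝ) < 4 ^ d - 4 ^ k := fun hk =>
    sub_pos.2 (pow_lt_pow_right₀ (by norm_num) hk)
  have hiii : ∀ i, 0 ≤ i → i + 1 ≤ d →
      (|altEigenvalue q n j i| < |altEigenvalue q n j (i + 1)| ↔
        (q = 2 ∧ n = 2 * d ∧ i + 1 = d) ∧ 1 ≤ j ∧ j + 1 ≤ d) ∧
      (|altEigenvalue q n j i| = |altEigenvalue q n j (i + 1)| ↔
        (q = 2 ∧ n = 2 * d ∧ i + 1 = d) ∧ j = d) ∧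
      (¬ (q = 2 ∧ n = 2 * d ∧ i + 1 = d) →
        |altEigenvalue q n j (i + 1)| < |altEigenvalue q n j i|) := by
    intro i _ hi
    refine ⟨?_, ?_, hc i hi⟩
    -- In the exceptional case both equivalences are read off from the sign of 4^d - 4^j; otherwise
    -- the strict decrease refutes their left sides.
    all_goals
      by_cases hex : q = 2 ∧ n = 2 * d ∧ i + 1 = d
      swap
      · have := hc i hi hex
        constructor
        · intro h
          linarith
        · exact fun h => absurd h.1 hex
      obtain ⟨u, hu, hdiff⟩ := hab i hex
      rcases eq_or_lt_of_le hjd with hjd' | hjd'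
      · rw [hjd', sub_self, mul_zero] at hdiff
        constructor
        · intro h
          first
            | exact ⟨hex, hjd'⟩
            | (rw [hjd'] at h; linarith)
        · intro h
          rw [hjd']
          linarith
      · have hpos := mul_pos hu (h4 hjd')
        constructor
        · intro h
          first
            | exact ⟨hex, hj, hjd'⟩
            | (exfalso; linarith)
        · intro h
          linarith
  refine ⟨hE, ⟨⟨d - j + 1, by omega, by omega, rfl⟩, ?_⟩, ⟨?_, ?_⟩, ⟨?_, ?_⟩, hiii⟩
  · rintro x ⟨i, -, hi, rfl⟩
    exact hmin i hi
  · exact (hE.hasEigenvalue_iff hj hjd _).2 ⟨d - j + 1, by omega, rfl⟩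
  · intro θ hθ
    obtain ⟨i, hi, rfl⟩ := (hE.hasEigenvalue_iff hj hjd θ).1 hθ
    exact hmin i hi
  · rintro ⟨-, hub⟩ ⟨h2, hn4, rfl⟩
    have hd2 : d = 2 := by omega
    have h1 := ((hiii 1 (by omega) (by omega)).1).2 ⟨⟨h2, by omega, by omega⟩, le_rfl, by omega⟩
    exact absurd (hub ⟨2, by omega, by omega, rfl⟩) (not_le.2 h1)
  · intro hne
    refine ⟨⟨1, le_rfl, by omega, rfl⟩, ?_⟩
    rintro x ⟨i, hi1, hid, rfl⟩
    -- For i < d monotonicity suffices. For i = d: d = 1 is trivial, d = 2 compares neighbours and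
    -- meets the exception, and for d ≥ 3 the index d - 2 ≥ 1 serves as intermediary.
    rcases eq_or_lt_of_le hid with rfl | hid'
    · rcases eq_or_lt_of_le hi1 with rfl | hi2
      · exact le_rfl
      rcases eq_or_lt_of_le (Nat.succ_le_of_lt hi2) with h2 | h3
      · have hi2 : i = 2 := h2.symm
        obtain ⟨ha, hb, hc'⟩ := hiii 1 (by omega) (by omega)
        rw [hi2]
        refine not_lt.1 fun hlt => ?_
        obtain ⟨⟨e1, e2, -⟩, -, e3⟩ := ha.1 hlt
        exact hne ⟨e1, by omega, by omega⟩
      · obtain ⟨e, he⟩ : ∃ e, e + 2 = i := ⟨i - 2, by omega⟩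
        rw [hA _ _ hjd, hA _ _ hjd]
        exact (abs_altKrawtchouk_last_le hqR hQ hj hjd he).trans
          (abs_altKrawtchouk_le_of_le hqR hQ hj hjd (by omega) (by omega))
    · rw [hA _ _ hjd, hA _ _ hjd]
      exact abs_altKrawtchouk_le_of_le hqR hQ hj hjd hi1 hid'
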